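/- Let $\mathbb F_q$ be a finite field with $q$ elements, $A=\mathbb F_q[T]$, $k_\infty=\mathbb F_q((1/T))$ with the absolute value $|\cdot|_\infty$ normalized by $|T|_\infty=q$, and let $\mathbb C_\infty$ be the completion of an algebraic closure of $k_\infty$. Let $\mathrm{Res}:k_\infty\to\mathbb F_q$ be the map $\sum_i c_iT^i\mapsto c_{-1}$. Fix $\widetilde T\in\mathbb C_\infty$ with $\widetilde T^{\,q-1}=-T$, and put $$\exp_C z=\sum_{n\ge 0}\frac{z^{q^n}}{D_n},\quad D_n=\prod_{i=0}^{n-1}\bigl(T^{q^n}-T^{q^i}\bigr),\qquad \varpi=T\,\widetilde T\prod_{i\ge 1}\bigl(1-T^{1-q^i}\bigr)^{-1}.$$ For $x\in k_\infty$ put $$\mathbf e(x)=\exp_C(\varpi x),\qquad \mathbf e^*(x)=\sum_{i\ge 0}\mathrm{Res}(T^ix)\,\alpha_i,\quad\text{where}\quad \sum_{i\ge 0}\alpha_it^i=\widetilde T^{-1}\prod_{i\ge 0}\Bigl(1-\frac{t}{T^{q^i}}\Bigr)\in\mathbb C_\infty[[t]].$$ For integers $N\ge 0$ put $$\Psi_N(z)=\prod_{a\in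 A,\ \deg a<N}(z-a)\Big/\prod_{a\in A\text{ monic},\ \deg a=N}a\qquad(\deg 0=-\infty).$$ Let $f\in A$ be monic, and let $a_1,\dots,a_{\deg f}$ and $b_1,\dots,b_{\deg f}$ be $f$-dual families in $A$, that is, $\mathrm{Res}(a_ib_j/f)=\delta_{ij}$ for all $i,j$. Let $a\in A$ with $\deg a<\deg f$. (i) For all integers $N\ge 0$, $$\sum_{i=1}^{\deg f}\mathbf e^*(a_i/f)^{q^{N+1}}\,\mathbf e(b_ia/f)=-\Psi_N(a/f).$$ (ii) If moreover $a$ is monic, then $$\sum_{i=1}^{\deg f}\mathbf e^*(a_i/f)\,\mathbf e(b_ia/f)^{q^{\deg f-\deg a-1}}=1.$$ -/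

import Mathlib

open scoped NNReal WithZero Polynomial

noncomputable section

namespace Carlitz

variable (Fq : Type*) [Field Fq] [Fintype Fq]

/-! ### The fields `k_∞` and `ℂ_∞` -/

/-- The field `k_∞ = 𝔽_q((1/T))`. The Laurent series variable stands for `1/T`, so `T^i` is
`HahnSeries.single (-i) 1`. -/
abbrev KInfty := LaurentSeries Fq

theorem one_lt_card_nnreal : (1 : ℝ≥0) < (Fintype.card Fq : ℝ≥0) := by
  exact_mod_cast Fintype.one_lt_card

/-- The `1/T`-adic valuation on `k_∞` as a rank one valuation, normalized by `|T|_∞ = q`. -/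
instance rankOneKInfty : (Valued.v : Valuation (KInfty Fq) ℤᵐ⁰).RankOne where
  hom' := (WithZeroMulInt.toNNReal (ne_zero_of_lt (one_lt_card_nnreal Fq))).comp
    MonoidWithZeroHom.ValueGroup₀.embedding
  strictMono' := (WithZeroMulInt.toNNReal_strictMono (one_lt_card_nnreal Fq)).comp
    MonoidWithZeroHom.ValueGroup₀.embedding_strictMono
  exists_val_nontrivial := by
    obtain ⟨x, hx⟩ := LaurentSeries.valuation_surjective Fq (WithZero.exp (1 : ℤ))
    refine ⟨x, ?_, ?_⟩
    · rw [hx]; exact WithZero.exp_ne_zero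
    · rw [hx]
      intro h
      rw [← WithZero.exp_zero, WithZero.exp_inj] at h
      exact one_ne_zero h

/-- `k_∞` as a complete ultrametric field, with the absolute value `|·|_∞`. -/
instance normedFieldKInfty : NontriviallyNormedField (KInfty Fq) :=
  Valued.toNontriviallyNormedField (KInfty Fq) ℤᵐ⁰

instance isUltrametricDistKInfty : IsUltrametricDist (KInfty Fq) :=
  IsUltrametricDist.isUltrametricDist_of_isNonarchimedean_norm
    (Valued.isNonarchimedean_norm (KInfty Fq) ℤᵐ⁰)

/-- An algebraic closure of `k_∞`. -/
abbrev KInftyBar := AlgebraicClosure (KInfty Fq)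

/-- The unique extension of `|·|_∞` to the algebraic closure. -/
instance normedFieldKInftyBar : NormedField (KInftyBar Fq) :=
  spectralNorm.normedField (KInfty Fq) (KInftyBar Fq)

instance normedAlgebraKInftyBar : NormedAlgebra (KInfty Fq) (KInftyBar Fq) :=
  spectralNorm.normedAlgebra (KInfty Fq) (KInftyBar Fq)

instance uniformContinuousConstSMulKInftyBar :
    UniformContinuousConstSMul (KInfty Fq) (KInftyBar Fq) :=
  uniformContinuousConstSMul_of_continuousConstSMul (KInfty Fq) (KInftyBar Fq)

/-- The field `ℂ_∞`, the completion of the algebraic closure of `k_∞`. -/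
abbrev CInfty := UniformSpace.Completion (KInftyBar Fq)

/-- The inclusion `k_∞ ⊆ ℂ_∞`. -/
def toCInfty : KInfty Fq →+* CInfty Fq := algebraMap (KInfty Fq) (CInfty Fq)

/-- The inclusion `A = 𝔽_q[T] ⊆ k_∞`. -/
def polyToKInfty : Fq[X] →+* KInfty Fq :=
  (Polynomial.aeval (HahnSeries.single (-1 : ℤ) (1 : Fq) : KInfty Fq)).toRingHom

/-- The element `T` of `k_∞`. -/
def varK : KInfty Fq := polyToKInfty Fq Polynomial.X

/-- The element `T` of `ℂ_∞`. -/
def varC : CInfty Fq := toCInfty Fq (varK Fq)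

/-- `Res : k_∞ → 𝔽_q`, the coefficient of `T⁻¹`. -/
def res (x : KInfty Fq) : Fq := HahnSeries.coeff x 1

/-! ### The Carlitz exponential and its period; the functions `e` and `e*` -/

/-- `D_n = ∏_{i<n} (T^(q^n) - T^(q^i))`. -/
def carlitzD (n : ℕ) : CInfty Fq :=
  ∏ i ∈ Finset.range n,
    (varC Fq ^ (Fintype.card Fq ^ n) - varC Fq ^ (Fintype.card Fq ^ i))

/-- The Carlitz exponential `exp_C z = ∑ z^(q^n) / D_n`. -/
def carlitzExp (z : CInfty Fq) : CInfty Fq :=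
  ∑' n : ℕ, z ^ (Fintype.card Fq ^ n) / carlitzD Fq n

/-- `s` is a `(q-1)`-st root of `-T`. -/
def IsRootNegT (s : CInfty Fq) : Prop := s ^ (Fintype.card Fq - 1) = -varC Fq

/-- The fundamental period `ϖ = T s ∏_{i ≥ 1} (1 - T^(1 - q^i))⁻¹` of the Carlitz exponential,
for a `(q-1)`-st root `s` of `-T`. -/
def carlitzPeriod (s : CInfty Fq) : CInfty Fq :=
  varC Fq * s * ∏' i : ℕ, (1 - varC Fq ^ (1 - (Fintype.card Fq : ℤ) ^ (i + 1)))⁻¹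

/-- The function `e(x) = exp_C (ϖ x)` on `k_∞`. -/
def e (s : CInfty Fq) (x : KInfty Fq) : CInfty Fq :=
  carlitzExp Fq (carlitzPeriod Fq s * toCInfty Fq x)

open scoped PowerSeries.WithPiTopology in
/-- The power series `Ω^(-1)(t) = s⁻¹ ∏_{i ≥ 0} (1 - t / T^(q^i))` over `ℂ_∞`; the product converges
coefficientwise. -/
def omegaTwist (s : CInfty Fq) : PowerSeries (CInfty Fq) :=
  PowerSeries.C s⁻¹ *
    ∏' i : ℕ, (1 - PowerSeries.C (varC Fq ^ (Fintype.card Fq ^ i))⁻¹ * PowerSeries.X)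

/-- The function `e*(x) = ∑_i Res(T^i x) a_i` on `k_∞`, where `Ω^(-1)(t) = ∑_i a_i t^i`. -/
def eStar (s : CInfty Fq) (x : KInfty Fq) : CInfty Fq :=
  ∑' i : ℕ, toCInfty Fq (algebraMap Fq (KInfty Fq) (res Fq (varK Fq ^ i * x))) *
    PowerSeries.coeff i (omegaTwist Fq s)

/-! ### The polynomials `Ψ_N` and dual families -/

/-- `Ψ_N(z) = ∏_{a ∈ A, deg a < N} (z - a) / ∏_{a ∈ A monic, deg a = N} a`; both products are
finite, and `a = 0` occurs in the first one. -/
def carlitzPsi (N : ℕ) (z : KInfty Fq) : KInfty Fq :=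
  (∏ᶠ (a : Fq[X]) (_ : a.degree < (N : WithBot ℕ)), (z - polyToKInfty Fq a)) /
    ∏ᶠ (a : Fq[X]) (_ : a.Monic ∧ a.degree = (N : WithBot ℕ)), polyToKInfty Fq a

/-- The fraction `a / f`, as an element of `k_∞`. -/
def frac (a f : Fq[X]) : KInfty Fq := polyToKInfty Fq a / polyToKInfty Fq f

/-- The families `a_i`, `b_j` are `f`-dual: `Res(a_i b_j / f) = δ_ij`. -/
def IsDualFamily (f : Fq[X]) (a b : Fin f.natDegree → Fq[X]) : Prop :=
  ∀ i j, res Fq (frac Fq (a i * b j) f) = if i = j then 1 else 0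

end Carlitz

end

/-! Write `θ = T`, let `α_k` be the coefficients of `Ω^(-1)` and `λ_j` those of its inverse. For a
sequence `g` put `P_{m,n}(g) = ∑_k α_k^(q^m) g_k^(q^n)` (`pairing`), and write `P_{m,n}(x)` when
`g_k = e(T^k x)`.

Duality gives `T^k ≡ ∑_i Res(T^k a_i/f) b_i` modulo `f`. Since `e` is `𝔽_q`-linear and kills `A`,
and residues are fixed by Frobenius, expanding `e*` turns both sums of the theorem into values of
`P` at `x = a/f`: `P_{N+1,0}(x)` for (i) and `P_{0,n}(x)` with `n = deg f - deg a - 1` for (ii)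
(`sum_eStar_mul_e`).

The functional equation `Ω^(-1) = (t - θ) Ω`, where `Ω` is the Frobenius twist of `Ω^(-1)`, makes
the Carlitz module act on the `λ_j` as a backward shift, and an asymptotic argument identifies `λ_j`
with `e(T^(-j-1))` (`expSeries_period_div`). Hence `Ω^(-1) · (Ω^(-1))⁻¹ = 1` computes `P_{0,0}` on
powers of `1/T`, and the functional equation then computes `P_{1,0}`. By linearity and continuity
`P_{0,0}(x) = Res x` and `P_{1,0}(x) = -x` for `|x| < 1`.

Evaluating `P` at `T x` in two ways, through the recursion of the `α_k` or through that of `e(T^k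
x)`, gives `(θ^(q^m) - θ) P_{m+1,0} = P_{m,0}^q - P_{m,0}` (`pairing_succ_mul`). The `Ψ_N` obey the
same recursion, whence (i) (`pairing_succ_eSeq`). The second evaluation alone raises `n`, and yields
a coefficient of `x` when `x` is small enough, whence (ii) (`pairing_zero_pow_eSeq`). -/

noncomputable section

namespace Carlitz

/-! ### The Carlitz exponential over a complete ultrametric field -/

section Module

variable {L : Type*} [NormedField L]

/-- The product `∏_{i<n} (θ^(q^n) - θ^(q^i))`. -/
def expDenom (q : ℕ) (θ : L) (n : ℕ) : L :=
  ∏ i ∈ Finset.range n, (θ ^ (q ^ n) - θ ^ (q ^ i))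

/-- The exponential `∑ z^(q^n) / D_n` of the Carlitz module attached to `θ`. -/
def expSeries (q : ℕ) (θ z : L) : L := ∑' n : ℕ, z ^ (q ^ n) / expDenom q θ n

variable {q : ℕ} {θ : L}

theorem expDenom_zero : expDenom q θ 0 = 1 := by simp [expDenom]

theorem expDenom_succ (φ : L →+* L) (hφ : ∀ x, φ x = x ^ q) (n : ℕ) :
    expDenom q θ (n + 1) = (θ ^ q ^ (n + 1) - θ) * expDenom q θ n ^ q := by
  rw [expDenom, Finset.prod_range_succ', mul_comm, expDenom, ← hφ, map_prod, pow_zero, pow_one]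
  congr 1
  refine Finset.prod_congr rfl fun i _ => ?_
  rw [map_sub, hφ, hφ, ← pow_mul, ← pow_mul, pow_succ, pow_succ]

theorem pow_pow_add (φ : L →+* L) (hφ : ∀ x, φ x = x ^ q) (x y : L) (n : ℕ) :
    (x + y) ^ q ^ n = x ^ q ^ n + y ^ q ^ n := by
  induction n with
  | zero => simp
  | succ n ih => rw [pow_succ, pow_mul, pow_mul, pow_mul, ih, ← hφ, map_add, hφ, hφ]

theorem pow_pow_eq_self {c : L} (hc : c ^ q = c) (n : ℕ) : c ^ q ^ n = c := by
  induction n with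
  | zero => simp
  | succ n ih => rw [pow_succ, pow_mul, ih, hc]

theorem continuous_of_pow (φ : L →+* L) (hφ : ∀ x, φ x = x ^ q) : Continuous φ := by
  rw [show (φ : L → L) = fun x => x ^ q from funext hφ]
  fun_prop

theorem expSeries_zero (hq : 1 < q) : expSeries q θ 0 = 0 := by
  have : ∀ n : ℕ, q ^ n ≠ 0 := fun n => (pow_pos (by omega) n).ne'
  simp only [expSeries, zero_pow (this _), zero_div, tsum_zero]

theorem expSeries_mul_of_pow_eq {c : L} (hc : c ^ q = c) (x : L) :
    expSeries q θ (c * x) = c * expSeries q θ x := by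
  rw [expSeries, expSeries, ← tsum_mul_left]
  simp_rw [mul_pow, pow_pow_eq_self hc, mul_div_assoc]

variable [IsUltrametricDist L]

theorem norm_pow_sub_pow (hθ : 1 < ‖θ‖) {a b : ℕ} (h : b < a) :
    ‖θ ^ a - θ ^ b‖ = ‖θ‖ ^ a := by
  have h1 : ‖θ ^ b‖ < ‖θ ^ a‖ := by
    rw [norm_pow, norm_pow]; exact pow_lt_pow_right₀ hθ h
  rw [sub_eq_add_neg, IsUltrametricDist.norm_add_eq_max_of_norm_ne_norm
    (by rw [norm_neg]; exact h1.ne'),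
    norm_neg, max_eq_left h1.le, norm_pow]

theorem norm_expDenom (hθ : 1 < ‖θ‖) (hq : 1 < q) (n : ℕ) :
    ‖expDenom q θ n‖ = (‖θ‖ ^ n) ^ q ^ n := by
  rw [expDenom, norm_prod, Finset.prod_congr rfl fun i hi => norm_pow_sub_pow hθ
    (pow_lt_pow_right₀ hq (Finset.mem_range.1 hi))]
  simp [← pow_mul, mul_comm]

theorem expDenom_ne_zero (hθ : 1 < ‖θ‖) (hq : 1 < q) (n : ℕ) : expDenom q θ n ≠ 0 := by
  rw [← norm_ne_zero_iff, norm_expDenom hθ hq]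
  positivity

theorem norm_expSeries_term (hθ : 1 < ‖θ‖) (hq : 1 < q) (z : L) (n : ℕ) :
    ‖z ^ q ^ n / expDenom q θ n‖ = (‖z‖ / ‖θ‖ ^ n) ^ q ^ n := by
  rw [norm_div, norm_expDenom hθ hq, norm_pow, div_pow]

theorem summable_div_pow_pow {x : ℝ} (hx : 1 < x) (hq : 1 < q) {R : ℝ} (hR : 0 ≤ R) :
    Summable fun n : ℕ => (R / x ^ n) ^ q ^ n := by
  have h0 : Filter.Tendsto (fun n : ℕ => R / x ^ n) Filter.atTop (nhds 0) :=
    tendsto_const_nhds.div_atTop (tendsto_pow_atTop_atTop_of_one_lt hx)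
  have h1 : ∀ᶠ n : ℕ in Filter.atTop, R / x ^ n ≤ 1 / 2 :=
    (h0.eventually (gt_mem_nhds (by norm_num : (0 : ℝ) < 1 / 2))).mono fun _ h => h.le
  refine Summable.of_norm_bounded_eventually_nat (g := fun n => (1 / 2 : ℝ) ^ n)
    (summable_geometric_of_lt_one (by norm_num) (by norm_num)) ?_
  filter_upwards [h1] with n hn
  have h2 : 0 ≤ R / x ^ n := by positivity
  rw [Real.norm_of_nonneg (by positivity)]
  calc (R / x ^ n) ^ q ^ n ≤ (1 / 2 : ℝ) ^ q ^ n := pow_le_pow_left₀ h2 hn _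
    _ ≤ (1 / 2 : ℝ) ^ n :=
      pow_le_pow_of_le_one (by norm_num) (by norm_num) (Nat.lt_pow_self hq).le

/-- Together with `A`-periodicity, this bound on balls bounds `e` on all of `k_∞`. -/
theorem exists_norm_expSeries_le (hθ : 1 < ‖θ‖) (hq : 1 < q) (R : ℝ) :
    ∃ B, ∀ z : L, ‖z‖ ≤ R → ‖expSeries q θ z‖ ≤ B := by
  refine ⟨∑' n : ℕ, (R / ‖θ‖ ^ n) ^ q ^ n, fun z hz => ?_⟩
  have hR := (norm_nonneg z).trans hz
  refine tsum_of_norm_bounded (summable_div_pow_pow hθ hq hR).hasSum fun n => ?_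
  rw [norm_expSeries_term hθ hq]
  gcongr

variable [CompleteSpace L]

theorem summable_expSeries (hθ : 1 < ‖θ‖) (hq : 1 < q) (z : L) :
    Summable fun n : ℕ => z ^ q ^ n / expDenom q θ n := by
  refine Summable.of_norm ?_
  simp_rw [norm_expSeries_term hθ hq]
  exact summable_div_pow_pow hθ hq (norm_nonneg z)

theorem expSeries_add (hθ : 1 < ‖θ‖) (hq : 1 < q) (φ : L →+* L) (hφ : ∀ x, φ x = x ^ q)
    (x y : L) : expSeries q θ (x + y) = expSeries q θ x + expSeries q θ y := by
  rw [expSeries, expSeries, expSeries,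
    ← (summable_expSeries hθ hq x).tsum_add (summable_expSeries hθ hq y)]
  simp_rw [pow_pow_add φ hφ, add_div]

/-- Termwise, `D_(n+1) = (θ^(q^(n+1)) - θ) D_n^q` says `θ^(q^(n+1)) / D_(n+1) = θ / D_(n+1) + 1 /
D_n^q`. -/
theorem expSeries_theta_mul (hθ : 1 < ‖θ‖) (hq : 1 < q) (φ : L →+* L) (hφ : ∀ x, φ x = x ^ q)
    (z : L) : expSeries q θ (θ * z) = θ * expSeries q θ z + expSeries q θ z ^ q := by
  have hs := summable_expSeries hθ hq z
  have hs' := summable_expSeries hθ hq (θ * z)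
  rw [← hφ (expSeries q θ z), expSeries, expSeries,
    (hs.hasSum.map φ (continuous_of_pow φ hφ)).tsum_eq.symm,
    hs.tsum_eq_zero_add, hs'.tsum_eq_zero_add, mul_add, ← tsum_mul_left, add_assoc,
    ← Summable.tsum_add]
  · congr 1
    · simp [expDenom_zero]
    · congr 1
      ext n
      have h1 := expDenom_ne_zero hθ hq n
      have h2 := expDenom_ne_zero hθ hq (n + 1)
      have h3 := expDenom_succ (θ := θ) φ hφ n
      simp only [Function.comp_apply]
      rw [hφ, div_pow, mul_pow, ← pow_mul z, ← pow_succ, mul_div_assoc',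
        div_add_div _ _ h2 (pow_ne_zero _ h1),
        div_eq_div_iff h2 (mul_ne_zero h2 (pow_ne_zero _ h1)), h3]
      ring
  · exact ((summable_nat_add_iff 1).2 hs).mul_left θ
  · exact hs.map φ (continuous_of_pow φ hφ)

theorem norm_expSeries_sub_le (hθ : 1 < ‖θ‖) (hq : 1 < q) {z : L} (hz : ‖z‖ ≤ 1) :
    ‖expSeries q θ z - z‖ ≤ ‖z‖ ^ 2 := by
  have hs := summable_expSeries hθ hq z
  rw [expSeries, hs.tsum_eq_zero_add]
  simp only [pow_zero, pow_one, expDenom_zero, div_one, add_sub_cancel_left]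
  refine IsUltrametricDist.norm_tsum_le_of_forall_le_of_nonneg (by positivity) fun n => ?_
  rw [norm_expSeries_term hθ hq]
  have h1 : (1 : ℝ) ≤ ‖θ‖ ^ (n + 1) := one_le_pow₀ hθ.le
  calc (‖z‖ / ‖θ‖ ^ (n + 1)) ^ q ^ (n + 1) ≤ ‖z‖ ^ q ^ (n + 1) := by
        gcongr; exact div_le_self (norm_nonneg _) h1
    _ ≤ ‖z‖ ^ 2 := pow_le_pow_of_le_one (norm_nonneg _) hz
        ((show 2 ≤ q from hq).trans (Nat.le_self_pow (by omega) q))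

theorem norm_expSeries_le (hθ : 1 < ‖θ‖) (hq : 1 < q) {z : L} (hz : ‖z‖ ≤ 1) :
    ‖expSeries q θ z‖ ≤ ‖z‖ := by
  have h1 : ‖expSeries q θ z - z‖ ≤ ‖z‖ := (norm_expSeries_sub_le hθ hq hz).trans <| by
    rw [sq]; exact mul_le_of_le_one_left (norm_nonneg _) hz
  calc ‖expSeries q θ z‖ = ‖(expSeries q θ z - z) + z‖ := by rw [sub_add_cancel]
    _ ≤ max _ _ := IsUltrametricDist.norm_add_le_max _ _
    _ ≤ ‖z‖ := max_le h1 le_rfl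

/-- The Carlitz exponential as a homomorphism of additive groups. -/
def expHom (hθ : 1 < ‖θ‖) (hq : 1 < q) (φ : L →+* L) (hφ : ∀ x, φ x = x ^ q) : L →+ L where
  toFun := expSeries q θ
  map_zero' := expSeries_zero hq
  map_add' := expSeries_add hθ hq φ hφ

theorem continuous_expSeries (hθ : 1 < ‖θ‖) (hq : 1 < q) (φ : L →+* L) (hφ : ∀ x, φ x = x ^ q) :
    Continuous (expSeries q θ) := by
  refine continuous_of_continuousAt_zero (expHom hθ hq φ hφ) ?_
  change Filter.Tendsto (expSeries q θ) (nhds 0) (nhds (expSeries q θ 0))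
  rw [expSeries_zero hq]
  refine squeeze_zero_norm' ?_ (tendsto_norm_zero (E := L))
  filter_upwards [Metric.closedBall_mem_nhds (0 : L) one_pos] with z hz
  exact norm_expSeries_le hθ hq (by simpa using hz)

end Module

/-! ### The power series `Ω^(-1)`, its inverse and their functional equations -/

section Twist

open PowerSeries
open scoped PowerSeries.WithPiTopology

variable {L : Type*} [NormedField L]

theorem prod_C_mul_X {ι : Type*} (c : ι → L) (S : Finset ι) :
    ∏ i ∈ S, (C (c i) * X : L⟦X⟧) = C (∏ i ∈ S, c i) * X ^ S.card := by
  rw [Finset.prod_mul_distrib, Finset.prod_const, map_prod]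

/-- A finite set `S` of factors contributes only in degree `|S|`, with norm the product of the `‖c
i‖` over `S`; these finite products are summable because `∑ ‖c i‖` is. -/
theorem multipliable_one_sub_C_mul_X [CompleteSpace L] {c : ℕ → L}
    (hc : Summable fun i => ‖c i‖) : Multipliable fun i => (1 - C (c i) * X : L⟦X⟧) := by
  simp_rw [sub_eq_add_neg, ← neg_mul, ← map_neg]
  refine multipliable_one_add_of_summable_prod ?_
  rw [WithPiTopology.summable_iff_summable_coeff]
  intro k
  have hs := summable_finsetProd_of_summable_nonneg (fun i => norm_nonneg (c i)) hc
  refine Summable.of_norm_bounded hs fun S => ?_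
  rw [prod_C_mul_X, coeff_C_mul, coeff_X_pow, norm_mul, norm_prod]
  simp_rw [norm_neg]
  refine mul_le_of_le_one_right (Finset.prod_nonneg fun _ _ => norm_nonneg _) ?_
  split_ifs <;> simp

/-- The coefficients of `f` are bounded by the powers of `ρ`. -/
def CoeffBound (ρ : ℝ) (f : L⟦X⟧) : Prop := ∀ k, ‖coeff k f‖ ≤ ρ ^ k

variable {ρ : ℝ}

theorem coeffBound_one (hρ : 0 ≤ ρ) : CoeffBound ρ (1 : L⟦X⟧) := fun k => by
  rw [coeff_one]
  split_ifs with h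
  · simp [h]
  · simpa using pow_nonneg hρ k

theorem isClosed_coeffBound : IsClosed {f : L⟦X⟧ | CoeffBound ρ f} := by
  simp only [CoeffBound, Set.ofPred_forall]
  exact isClosed_iInter fun k =>
    isClosed_le (WithPiTopology.continuous_coeff (R := L) k).norm continuous_const

theorem coeffBound_one_sub (hρ : 0 ≤ ρ) {c : L} (hc : ‖c‖ ≤ ρ) :
    CoeffBound ρ (1 - C c * X : L⟦X⟧) := fun k => by
  rw [map_sub, coeff_one, coeff_C_mul, coeff_X]
  rcases k with _ | _ | k
  · simp
  · simpa using hc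
  · simpa using pow_nonneg hρ _

theorem constantCoeff_tprod [CompleteSpace L] {c : ℕ → L} (hc : Summable fun i => ‖c i‖) :
    constantCoeff (∏' i, (1 - C (c i) * X : L⟦X⟧)) = 1 := by
  rw [(multipliable_one_sub_C_mul_X hc).map_tprod (constantCoeff (R := L))
    (WithPiTopology.continuous_constantCoeff L)]
  simp

theorem continuous_map {φ : L →+* L} (hφ : Continuous φ) :
    Continuous (PowerSeries.map φ : L⟦X⟧ → L⟦X⟧) := by
  rw [continuous_iff_continuousAt]
  intro f
  rw [ContinuousAt, WithPiTopology.tendsto_iff_coeff_tendsto]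
  intro d
  simp only [coeff_map]
  exact (hφ.comp (WithPiTopology.continuous_coeff (R := L) d)).continuousAt

variable [IsUltrametricDist L]

theorem CoeffBound.mul (hρ : 0 ≤ ρ) {f g : L⟦X⟧} (hf : CoeffBound ρ f) (hg : CoeffBound ρ g) :
    CoeffBound ρ (f * g) := fun k => by
  rw [coeff_mul]
  refine IsUltrametricDist.norm_sum_le_of_forall_le_of_nonneg (pow_nonneg hρ k) fun x hx => ?_
  rw [← Finset.HasAntidiagonal.mem_antidiagonal.1 hx, pow_add, norm_mul]
  exact mul_le_mul (hf _) (hg _) (norm_nonneg _) (pow_nonneg hρ _)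

theorem CoeffBound.inv (hρ : 0 ≤ ρ) {f : L⟦X⟧} (hf : CoeffBound ρ f)
    (h1 : constantCoeff f = 1) : CoeffBound ρ f⁻¹ := fun k => by
  induction k using Nat.strong_induction_on with
  | _ k ih =>
    rw [PowerSeries.coeff_inv, h1]
    split_ifs with hk
    · simp [hk]
    · rw [inv_one, neg_one_mul, norm_neg]
      refine IsUltrametricDist.norm_sum_le_of_forall_le_of_nonneg (pow_nonneg hρ k) fun x hx => ?_
      split_ifs with h
      · rw [← Finset.HasAntidiagonal.mem_antidiagonal.1 hx, pow_add, norm_mul]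
        exact mul_le_mul (hf _) (ih _ h) (norm_nonneg _) (pow_nonneg hρ _)
      · simpa using pow_nonneg hρ k

theorem coeffBound_tprod [CompleteSpace L] {c : ℕ → L} (hc : Summable fun i => ‖c i‖)
    (hρ : 0 ≤ ρ) (h : ∀ i, ‖c i‖ ≤ ρ) :
    CoeffBound ρ (∏' i, (1 - C (c i) * X : L⟦X⟧)) := by
  refine isClosed_coeffBound.mem_of_tendsto (multipliable_one_sub_C_mul_X hc).hasProd
    (Filter.Eventually.of_forall fun S => ?_)
  exact Finset.prod_induction _ (CoeffBound ρ) (fun _ _ => CoeffBound.mul hρ) (coeffBound_one hρ)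
    fun i _ => coeffBound_one_sub hρ (h i)

variable {q : ℕ} {θ s : L}

/-- The product `∏_{i ≥ 0} (1 - X / θ^(q^i))`. -/
def twistProd (q : ℕ) (θ : L) : L⟦X⟧ := ∏' i : ℕ, (1 - C (θ ^ (q ^ i))⁻¹ * X)

/-- The power series `s⁻¹ ∏_{i ≥ 0} (1 - X / θ^(q^i))`. -/
def twist (q : ℕ) (θ s : L) : L⟦X⟧ := C s⁻¹ * twistProd q θ

/-- The inverse of the power series `twist q θ s`. -/
def twistInv (q : ℕ) (θ s : L) : L⟦X⟧ := C s * (twistProd q θ)⁻¹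

omit [IsUltrametricDist L] in
theorem norm_inv_pow_le (hθ : 1 < ‖θ‖) (hq : 1 < q) (i : ℕ) :
    ‖(θ ^ q ^ i)⁻¹‖ ≤ ‖θ‖⁻¹ ^ (i + 1) := by
  rw [norm_inv, norm_pow, ← inv_pow]
  exact pow_le_pow_of_le_one (by positivity) (inv_le_one_of_one_le₀ hθ.le) (Nat.lt_pow_self hq)

omit [IsUltrametricDist L] in
theorem summable_norm_inv_pow (hθ : 1 < ‖θ‖) (hq : 1 < q) :
    Summable fun i : ℕ => ‖(θ ^ q ^ i)⁻¹‖ :=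
  Summable.of_nonneg_of_le (fun _ => norm_nonneg _) (norm_inv_pow_le hθ hq)
    ((summable_nat_add_iff 1).2
      (summable_geometric_of_lt_one (by positivity) (inv_lt_one_of_one_lt₀ hθ)))

variable [CompleteSpace L]

theorem coeffBound_twistProd (hθ : 1 < ‖θ‖) (hq : 1 < q) :
    CoeffBound ‖θ‖⁻¹ (twistProd q θ) :=
  coeffBound_tprod (summable_norm_inv_pow hθ hq) (by positivity) fun i =>
    (norm_inv_pow_le hθ hq i).trans <|
      pow_le_of_le_one (by positivity) (inv_le_one_of_one_le₀ hθ.le) (by omega)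

omit [IsUltrametricDist L] in
theorem constantCoeff_twistProd (hθ : 1 < ‖θ‖) (hq : 1 < q) :
    constantCoeff (twistProd q θ) = 1 :=
  constantCoeff_tprod (summable_norm_inv_pow hθ hq)

omit [IsUltrametricDist L] in
theorem tprod_one_sub_eq_zero_mul {c : ℕ → L} (hc : Summable fun i => ‖c i‖) :
    (∏' i, (1 - C (c i) * X) : L⟦X⟧) = (1 - C (c 0) * X) * ∏' i, (1 - C (c (i + 1)) * X) := by
  have hm : Multipliable fun i => (1 - C (c (i + 1)) * X : L⟦X⟧) :=
    multipliable_one_sub_C_mul_X (c := fun i => c (i + 1)) ((summable_nat_add_iff 1).2 hc)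
  exact tprod_eq_zero_mul' hm

omit [IsUltrametricDist L] in
theorem map_tprod_one_sub {c : ℕ → L} (hc : Summable fun i => ‖c i‖) {φ : L →+* L}
    (hφ : Continuous φ) : PowerSeries.map φ (∏' i, (1 - C (c i) * X) : L⟦X⟧) =
      ∏' i, (1 - C (φ (c i)) * X) := by
  rw [(multipliable_one_sub_C_mul_X hc).map_tprod (PowerSeries.map φ) (continuous_map hφ)]
  exact tprod_congr fun i => by rw [map_sub, map_one, map_mul, map_C, map_X]

omit [IsUltrametricDist L] in
theorem twistProd_eq (hθ : 1 < ‖θ‖) (hq : 1 < q) (φ : L →+* L) (hφ : ∀ x, φ x = x ^ q) :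
    twistProd q θ = (1 - C θ⁻¹ * X) * PowerSeries.map φ (twistProd q θ) := by
  have hc := summable_norm_inv_pow hθ hq
  have h1 : ∀ i : ℕ, φ (θ ^ q ^ i)⁻¹ = (θ ^ q ^ (i + 1))⁻¹ := fun i => by
    rw [map_inv₀, hφ, ← pow_mul, pow_succ]
  rw [twistProd, map_tprod_one_sub hc (continuous_of_pow φ hφ)]
  simp_rw [h1]
  rw [tprod_one_sub_eq_zero_mul hc, pow_zero, pow_one]

omit [IsUltrametricDist L] in
theorem twist_mul_twistInv (hθ : 1 < ‖θ‖) (hq : 1 < q) (hs : s ≠ 0) :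
    twist q θ s * twistInv q θ s = 1 := by
  have h : twistProd q θ * (twistProd q θ)⁻¹ = 1 :=
    PowerSeries.mul_inv_cancel _ (by rw [constantCoeff_twistProd hθ hq]; exact one_ne_zero)
  rw [twist, twistInv, mul_mul_mul_comm, h, ← map_mul, inv_mul_cancel₀ hs, map_one, one_mul]

-- Frobenius on coefficients removes the factor `1 - X/θ` from the product, and `s⁻¹ = -θ s^(-q)`
-- turns that factor into `X - θ`.
omit [IsUltrametricDist L] in
theorem twist_eq (hθ : 1 < ‖θ‖) (hq : 1 < q) (φ : L →+* L) (hφ : ∀ x, φ x = x ^ q)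
    (hs : s ^ (q - 1) = -θ) (hs0 : s ≠ 0) :
    twist q θ s = (X - C θ) * PowerSeries.map φ (twist q θ s) := by
  have hθ0 : θ ≠ 0 := by rintro rfl; simp at hs; exact hs0 hs.1
  have h1 : (s ^ q)⁻¹ * (-θ) = s⁻¹ := by
    rw [← hs, show q = q - 1 + 1 by omega, pow_succ, Nat.add_sub_cancel]
    have := pow_ne_zero (q - 1) hs0
    field_simp
  have h2 : (C θ : L⟦X⟧) * C θ⁻¹ = 1 := by rw [← map_mul, mul_inv_cancel₀ hθ0, map_one]
  have h3 : (C s⁻¹ : L⟦X⟧) = C (s ^ q)⁻¹ * (- C θ) := by rw [← map_neg, ← map_mul, h1]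
  rw [twist, map_mul, map_C, hφ, inv_pow]
  nth_rewrite 1 [twistProd_eq hθ hq φ hφ, h3]
  linear_combination (C (s ^ q)⁻¹ * X * PowerSeries.map φ (twistProd q θ)) * h2

omit [IsUltrametricDist L] in
theorem map_twistInv (hθ : 1 < ‖θ‖) (hq : 1 < q) (φ : L →+* L) (hφ : ∀ x, φ x = x ^ q)
    (hs : s ^ (q - 1) = -θ) (hs0 : s ≠ 0) :
    PowerSeries.map φ (twistInv q θ s) = (X - C θ) * twistInv q θ s := by
  have h1 := twist_mul_twistInv hθ hq hs0
  have h2 := congrArg (PowerSeries.map φ) h1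
  rw [map_mul, map_one] at h2
  have h3 := twist_eq hθ hq φ hφ hs hs0
  linear_combination (-PowerSeries.map φ (twistInv q θ s)) * h1 +
    (X - C θ) * twistInv q θ s * h2 +
    twistInv q θ s * PowerSeries.map φ (twistInv q θ s) * h3

theorem norm_coeff_twist_le (hθ : 1 < ‖θ‖) (hq : 1 < q) (k : ℕ) :
    ‖coeff k (twist q θ s)‖ ≤ ‖s‖⁻¹ * ‖θ‖⁻¹ ^ k := by
  rw [twist, coeff_C_mul, norm_mul, norm_inv]
  exact mul_le_mul_of_nonneg_left (coeffBound_twistProd hθ hq k) (by positivity)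

theorem norm_coeff_twistInv_le (hθ : 1 < ‖θ‖) (hq : 1 < q) (k : ℕ) :
    ‖coeff k (twistInv q θ s)‖ ≤ ‖s‖ * ‖θ‖⁻¹ ^ k := by
  rw [twistInv, coeff_C_mul, norm_mul]
  exact mul_le_mul_of_nonneg_left ((coeffBound_twistProd hθ hq).inv (by positivity)
    (constantCoeff_twistProd hθ hq) k) (by positivity)

omit [IsUltrametricDist L] in
theorem coeff_zero_twistInv (hθ : 1 < ‖θ‖) (hq : 1 < q) : coeff 0 (twistInv q θ s) = s := by
  rw [twistInv, coeff_C_mul, coeff_zero_eq_constantCoeff_apply, constantCoeff_inv,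
    constantCoeff_twistProd hθ hq, inv_one, mul_one]

omit [IsUltrametricDist L] in
theorem coeff_succ_twist (hθ : 1 < ‖θ‖) (hq : 1 < q) (φ : L →+* L) (hφ : ∀ x, φ x = x ^ q)
    (hs : s ^ (q - 1) = -θ) (hs0 : s ≠ 0) (k : ℕ) :
    coeff (k + 1) (twist q θ s) =
      coeff k (twist q θ s) ^ q - θ * coeff (k + 1) (twist q θ s) ^ q := by
  have h := congrArg (coeff (k + 1)) (twist_eq hθ hq φ hφ hs hs0)
  rwa [sub_mul, map_sub, coeff_succ_X_mul, coeff_C_mul, coeff_map, coeff_map, hφ, hφ] at h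

omit [IsUltrametricDist L] in
theorem coeff_zero_twist_eq (hθ : 1 < ‖θ‖) (hq : 1 < q) (φ : L →+* L) (hφ : ∀ x, φ x = x ^ q)
    (hs : s ^ (q - 1) = -θ) (hs0 : s ≠ 0) :
    coeff 0 (twist q θ s) = - (θ * coeff 0 (twist q θ s) ^ q) := by
  have h := congrArg (coeff 0) (twist_eq hθ hq φ hφ hs hs0)
  rwa [sub_mul, map_sub, coeff_zero_X_mul, coeff_C_mul, coeff_map, hφ, zero_sub] at h

-- The Carlitz action of `θ` sends `λ_(k+1)` to `λ_k`, exactly as for the values of the exponential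
-- at `ϖ/θ^(k+1)`.
omit [IsUltrametricDist L] in
theorem coeff_succ_twistInv (hθ : 1 < ‖θ‖) (hq : 1 < q) (φ : L →+* L) (hφ : ∀ x, φ x = x ^ q)
    (hs : s ^ (q - 1) = -θ) (hs0 : s ≠ 0) (k : ℕ) :
    coeff k (twistInv q θ s) =
      θ * coeff (k + 1) (twistInv q θ s) + coeff (k + 1) (twistInv q θ s) ^ q := by
  have h := congrArg (coeff (k + 1)) (map_twistInv hθ hq φ hφ hs hs0)
  rw [sub_mul, map_sub, coeff_succ_X_mul, coeff_C_mul, coeff_map, hφ] at h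
  rw [h]; ring

end Twist

/-! ### The period and the coefficients `λ_j` as torsion values -/

section Period

open PowerSeries Filter Topology

variable {L : Type*} [NormedField L] {q : ℕ} {θ s : L}

/-- The period `θ s ∏_{i ≥ 1} (1 - θ^(1 - q^i))⁻¹`. -/
def period (q : ℕ) (θ s : L) : L :=
  θ * s * ∏' i : ℕ, (1 - θ ^ (1 - (q : ℤ) ^ (i + 1)))⁻¹

theorem pow_pow_neg (φ : L →+* L) (hφ : ∀ x, φ x = x ^ q) (x : L) (n : ℕ) :
    (-x) ^ q ^ n = -x ^ q ^ n := by
  induction n with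
  | zero => simp
  | succ n ih => rw [pow_succ, pow_mul, pow_mul, ih, ← hφ, map_neg, hφ]

theorem pow_pow_sub (φ : L →+* L) (hφ : ∀ x, φ x = x ^ q) (x y : L) (n : ℕ) :
    (x - y) ^ q ^ n = x ^ q ^ n - y ^ q ^ n := by
  rw [sub_eq_add_neg, pow_pow_add φ hφ, pow_pow_neg φ hφ, sub_eq_add_neg]

theorem pow_eq_neg_mul (hq : 1 < q) (hs : s ^ (q - 1) = -θ) : s ^ q = -(θ * s) := by
  rw [show q = q - 1 + 1 by omega, pow_succ, hs, neg_mul]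

/-- The sum `∑_j λ_j^(q^n) θ^j`, where `∑_j λ_j X^j` is the inverse of the power series `twist`. -/
def twistInvEval (q : ℕ) (θ s : L) (n : ℕ) : L :=
  ∑' j : ℕ, coeff j (twistInv q θ s) ^ q ^ n * θ ^ j

variable [IsUltrametricDist L] [CompleteSpace L]

theorem norm_twistInvEval_term_le (hθ : 1 < ‖θ‖) (hq : 1 < q) (n j : ℕ) :
    ‖coeff j (twistInv q θ s) ^ q ^ n * θ ^ j‖ ≤
      ‖s‖ ^ q ^ n * (‖θ‖⁻¹ ^ (q ^ n - 1)) ^ j := by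
  have hθ0 : ‖θ‖ ≠ 0 := by positivity
  have h1 : 1 ≤ q ^ n := Nat.one_le_pow _ _ (by omega)
  rw [norm_mul, norm_pow, norm_pow]
  calc ‖coeff j (twistInv q θ s)‖ ^ q ^ n * ‖θ‖ ^ j
      ≤ (‖s‖ * ‖θ‖⁻¹ ^ j) ^ q ^ n * ‖θ‖ ^ j := by
        gcongr; exact norm_coeff_twistInv_le hθ hq j
    _ = ‖s‖ ^ q ^ n * (‖θ‖⁻¹ ^ (q ^ n - 1)) ^ j := by
        obtain ⟨m, hm⟩ := Nat.exists_eq_add_of_le h1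
        rw [hm, Nat.add_sub_cancel_left, mul_pow, mul_assoc, ← pow_mul, ← pow_mul,
          mul_add, mul_one, pow_add, mul_comm m j]
        congr 1
        rw [pow_add, mul_right_comm, ← mul_pow, inv_mul_cancel₀ hθ0, one_pow, one_mul]

theorem summable_twistInvEval (hθ : 1 < ‖θ‖) (hq : 1 < q) (n : ℕ) :
    Summable fun j : ℕ => coeff j (twistInv q θ s) ^ q ^ (n + 1) * θ ^ j := by
  refine Summable.of_norm_bounded ?_ (norm_twistInvEval_term_le hθ hq (n + 1))
  refine (summable_geometric_of_lt_one (by positivity) ?_).mul_left _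
  exact pow_lt_one₀ (by positivity) (inv_lt_one_of_one_lt₀ hθ)
    (Nat.sub_ne_zero_of_lt (Nat.one_lt_pow (by omega) hq))

/-- This is the `(n+1)`-fold twist of `map_twistInv`, with factor `X - θ^(q^(n+1))`, evaluated at `X
= θ`. At least one twist is needed for the norm bounds to give convergence there. -/
theorem twistInvEval_succ (hθ : 1 < ‖θ‖) (hq : 1 < q) (φ : L →+* L) (hφ : ∀ x, φ x = x ^ q)
    (hs : s ^ (q - 1) = -θ) (hs0 : s ≠ 0) (n : ℕ) :
    twistInvEval q θ s (n + 2) = (θ - θ ^ q ^ (n + 1)) * twistInvEval q θ s (n + 1) := by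
  have hsum := summable_twistInvEval (s := s) hθ hq n
  have hsum' := (summable_nat_add_iff 1).2 hsum
  have h0 : s ^ q ^ (n + 2) = -(θ ^ q ^ (n + 1) * s ^ q ^ (n + 1)) := by
    rw [pow_succ' q (n + 1), pow_mul, pow_eq_neg_mul hq hs, pow_pow_neg φ hφ, mul_pow]
  have h1 : ∀ j, coeff (j + 1) (twistInv q θ s) ^ q ^ (n + 2) * θ ^ (j + 1) =
      θ * (coeff j (twistInv q θ s) ^ q ^ (n + 1) * θ ^ j) -
      θ ^ q ^ (n + 1) * (coeff (j + 1) (twistInv q θ s) ^ q ^ (n + 1) * θ ^ (j + 1)) := by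
    intro j
    have h := coeff_succ_twistInv hθ hq φ hφ hs hs0 j
    have h' : coeff (j + 1) (twistInv q θ s) ^ q =
      coeff j (twistInv q θ s) - θ * coeff (j + 1) (twistInv q θ s) := by rw [h]; ring
    rw [pow_succ' q (n + 1), pow_mul, h', pow_pow_sub φ hφ, mul_pow]
    ring
  rw [twistInvEval, (summable_twistInvEval hθ hq (n + 1)).tsum_eq_zero_add]
  simp_rw [h1]
  rw [(hsum.mul_left θ).tsum_sub (hsum'.mul_left _), tsum_mul_left, tsum_mul_left, pow_zero,
    mul_one, coeff_zero_twistInv hθ hq, h0]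
  have h2 := hsum.tsum_eq_zero_add
  rw [pow_zero, mul_one, coeff_zero_twistInv hθ hq] at h2
  rw [twistInvEval]
  linear_combination (θ ^ q ^ (n + 1)) * h2

theorem tendsto_twistInvEval_div (hθ : 1 < ‖θ‖) (hq : 1 < q) (hs0 : s ≠ 0) :
    Tendsto (fun n => twistInvEval q θ s (n + 1) / s ^ q ^ (n + 1)) atTop (𝓝 1) := by
  have hρ : ‖θ‖⁻¹ < 1 := inv_lt_one_of_one_lt₀ hθ
  rw [tendsto_iff_norm_sub_tendsto_zero]
  refine squeeze_zero (fun _ => norm_nonneg _) (g := fun n => ‖θ‖⁻¹ ^ n) (fun n => ?_)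
    (tendsto_pow_atTop_nhds_zero_of_lt_one (by positivity) hρ)
  have hs1 : s ^ q ^ (n + 1) ≠ 0 := pow_ne_zero _ hs0
  rw [div_sub_one hs1, norm_div, div_le_iff₀ (norm_pos_iff.2 hs1), twistInvEval,
    (summable_twistInvEval hθ hq n).tsum_eq_zero_add, pow_zero, mul_one, coeff_zero_twistInv hθ hq,
    add_sub_cancel_left]
  refine IsUltrametricDist.norm_tsum_le_of_forall_le_of_nonneg (by positivity) fun j => ?_
  refine (norm_twistInvEval_term_le hθ hq (n + 1) (j + 1)).trans ?_
  rw [norm_pow, mul_comm]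
  gcongr
  rw [← pow_mul]
  refine pow_le_pow_of_le_one (by positivity) hρ.le ?_
  have h1 : n + 1 < q ^ (n + 1) := Nat.lt_pow_self hq
  calc n ≤ q ^ (n + 1) - 1 := by omega
    _ ≤ _ := Nat.le_mul_of_pos_right _ (by omega)

omit [IsUltrametricDist L] [CompleteSpace L] in
theorem zpow_one_sub_mul (hθ : θ ≠ 0) (n : ℕ) :
    θ ^ (1 - (q : ℤ) ^ n) * θ ^ q ^ n = θ := by
  rw [← zpow_natCast θ (q ^ n), ← zpow_add₀ hθ]
  simp

theorem twistInvEval_div_eq (hθ : 1 < ‖θ‖) (hq : 1 < q) (φ : L →+* L) (hφ : ∀ x, φ x = x ^ q)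
    (hs : s ^ (q - 1) = -θ) (hs0 : s ≠ 0) (n : ℕ) :
    twistInvEval q θ s (n + 1) / s ^ q ^ (n + 1) = twistInvEval q θ s 1 / s ^ q *
      ∏ i ∈ Finset.range n, (1 - θ ^ (1 - (q : ℤ) ^ (i + 1))) := by
  have hθ0 : θ ≠ 0 := norm_pos_iff.1 (by positivity)
  induction n with
  | zero => simp
  | succ n ih =>
    have h0 : s ^ q ^ (n + 2) = -(θ ^ q ^ (n + 1) * s ^ q ^ (n + 1)) := by
      rw [pow_succ' q (n + 1), pow_mul, pow_eq_neg_mul hq hs, pow_pow_neg φ hφ, mul_pow]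
    rw [Finset.prod_range_succ, ← mul_assoc, ← ih, twistInvEval_succ hθ hq φ hφ hs hs0, h0]
    have h1 := zpow_one_sub_mul (q := q) hθ0 (n + 1)
    have h2 := pow_ne_zero (q ^ (n + 1)) hs0
    have h3 := pow_ne_zero (q ^ (n + 1)) hθ0
    rw [div_mul_eq_mul_div, div_eq_div_iff (neg_ne_zero.2 (mul_ne_zero h3 h2)) h2]
    linear_combination (-twistInvEval q θ s (n + 1) * s ^ q ^ (n + 1)) * h1

omit [IsUltrametricDist L] [CompleteSpace L] in
theorem summable_norm_zpow (hθ : 1 < ‖θ‖) (hq : 1 < q) :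
    Summable fun i : ℕ => ‖θ ^ (1 - (q : ℤ) ^ (i + 1))‖ := by
  have hρ : ‖θ‖⁻¹ < 1 := inv_lt_one_of_one_lt₀ hθ
  refine Summable.of_nonneg_of_le (fun _ => norm_nonneg _) (fun i => ?_)
    (summable_geometric_of_lt_one (by positivity) hρ)
  have h1 : i + 1 < q ^ (i + 1) := Nat.lt_pow_self hq
  rw [norm_zpow, ← zpow_natCast, inv_zpow, ← zpow_neg]
  refine zpow_le_zpow_right₀ hθ.le ?_
  have h2 : ((i + 1 : ℕ) : ℤ) < ((q ^ (i + 1) : ℕ) : ℤ) := by exact_mod_cast h1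
  push_cast at h2
  omega

omit [IsUltrametricDist L] in
theorem multipliable_one_sub {a : ℕ → L} (ha : Summable fun i => ‖a i‖) :
    Multipliable fun i => 1 - a i := by
  have h : Summable fun i => ‖-a i‖ := by simpa only [norm_neg] using ha
  simpa only [sub_eq_add_neg] using multipliable_one_add_of_summable h

/-- Iterating `twistInvEval_succ` builds up the product defining the period. In the limit the term
`j = 0` dominates, so the normalized value tends to `1`; then `s^q = -θ s` supplies the sign. -/
theorem period_eq (hθ : 1 < ‖θ‖) (hq : 1 < q) (φ : L →+* L) (hφ : ∀ x, φ x = x ^ q)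
    (hs : s ^ (q - 1) = -θ) (hs0 : s ≠ 0) : period q θ s = -twistInvEval q θ s 1 := by
  have hθ0 : θ ≠ 0 := norm_pos_iff.1 (by positivity)
  have hm := multipliable_one_sub (summable_norm_zpow hθ hq)
  have h1 : twistInvEval q θ s 1 / s ^ q * ∏' i : ℕ, (1 - θ ^ (1 - (q : ℤ) ^ (i + 1))) = 1 := by
    refine tendsto_nhds_unique ?_ (tendsto_twistInvEval_div hθ hq hs0)
    simp_rw [twistInvEval_div_eq hθ hq φ hφ hs hs0]
    exact hm.hasProd.tendsto_prod_nat.const_mul _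
  have h2 := right_ne_zero_of_mul_eq_one h1
  have h3 := (hm.hasProd.inv₀ h2).tprod_eq
  rw [period, h3, ← eq_inv_of_mul_eq_one_left h1, pow_eq_neg_mul hq hs]
  field_simp

-- The sum telescopes by `λ_(j+1)^q = λ_j - θ λ_(j+1)`; its limit gives the asymptotics `θ^(n+1) λ_n
-- → ϖ`.
omit [IsUltrametricDist L] in
theorem sum_coeff_twistInv_pow (hθ : 1 < ‖θ‖) (hq : 1 < q) (φ : L →+* L) (hφ : ∀ x, φ x = x ^ q)
    (hs : s ^ (q - 1) = -θ) (hs0 : s ≠ 0) (n : ℕ) :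
    ∑ j ∈ Finset.range (n + 1), coeff j (twistInv q θ s) ^ q ^ 1 * θ ^ j =
      -(θ ^ (n + 1) * coeff n (twistInv q θ s)) := by
  induction n with
  | zero => simp [coeff_zero_twistInv hθ hq, pow_eq_neg_mul hq hs, -coeff_zero_eq_constantCoeff]
  | succ n ih =>
    rw [Finset.sum_range_succ, ih, coeff_succ_twistInv hθ hq φ hφ hs hs0 n]
    ring

theorem tendsto_coeff_twistInv (hθ : 1 < ‖θ‖) (hq : 1 < q) (φ : L →+* L) (hφ : ∀ x, φ x = x ^ q)
    (hs : s ^ (q - 1) = -θ) (hs0 : s ≠ 0) :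
    Tendsto (fun n => θ ^ (n + 1) * coeff n (twistInv q θ s)) atTop (𝓝 (period q θ s)) := by
  have h := ((summable_twistInvEval (s := s) hθ hq 0).hasSum.tendsto_sum_nat.comp
    (tendsto_add_atTop_nat 1)).neg
  rw [zero_add, ← twistInvEval, ← period_eq hθ hq φ hφ hs hs0] at h
  refine h.congr fun n => ?_
  simp only [Function.comp_apply]
  rw [sum_coeff_twistInv_pow hθ hq φ hφ hs hs0, neg_neg]

theorem tendsto_pow_mul_expSeries (hθ : 1 < ‖θ‖) (hq : 1 < q) (w : L) :
    Tendsto (fun n => θ ^ (n + 1) * expSeries q θ (w * (θ ^ (n + 1))⁻¹)) atTop (𝓝 w) := by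
  have hθ0 : θ ≠ 0 := norm_pos_iff.1 (by positivity)
  have hρ : ‖θ‖⁻¹ < 1 := inv_lt_one_of_one_lt₀ hθ
  have ht : ∀ x : ℝ, Tendsto (fun n : ℕ => x * ‖θ‖⁻¹ ^ (n + 1)) atTop (𝓝 0) := fun x => by
    simpa using ((tendsto_pow_atTop_nhds_zero_of_lt_one (by positivity) hρ).comp
      (tendsto_add_atTop_nat 1)).const_mul x
  rw [tendsto_iff_norm_sub_tendsto_zero]
  refine squeeze_zero' (Eventually.of_forall fun _ => norm_nonneg _) ?_ (ht (‖w‖ ^ 2))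
  filter_upwards [(ht ‖w‖).eventually (gt_mem_nhds one_pos)] with n hn
  have hz : ‖w * (θ ^ (n + 1))⁻¹‖ = ‖w‖ * ‖θ‖⁻¹ ^ (n + 1) := by
    rw [norm_mul, norm_inv, norm_pow, inv_pow]
  have h1 := norm_expSeries_sub_le hθ hq (z := w * (θ ^ (n + 1))⁻¹) (by rw [hz]; exact hn.le)
  have h2 : θ ^ (n + 1) * expSeries q θ (w * (θ ^ (n + 1))⁻¹) - w =
      θ ^ (n + 1) * (expSeries q θ (w * (θ ^ (n + 1))⁻¹) - w * (θ ^ (n + 1))⁻¹) := by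
    have := pow_ne_zero (n + 1) hθ0
    field_simp
  rw [h2, norm_mul]
  calc ‖θ ^ (n + 1)‖ * _ ≤ ‖θ ^ (n + 1)‖ * (‖w‖ * ‖θ‖⁻¹ ^ (n + 1)) ^ 2 := by
        rw [← hz]; gcongr
    _ = ‖w‖ ^ 2 * ‖θ‖⁻¹ ^ (n + 1) := by
        have : ‖θ‖ ≠ 0 := by positivity
        rw [norm_pow, inv_pow]; field_simp

-- Uniqueness for the backward recursion: once `‖θ^(N+1) δ_N‖ ≤ ε ≤ 1`, the linear term dominates
-- and the bound passes down to every smaller index.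
omit [CompleteSpace L] in
theorem eq_zero_of_tendsto_pow_mul (hθ : 1 < ‖θ‖) (hq : 1 < q) {δ : ℕ → L}
    (hδ : ∀ n, δ n = θ * δ (n + 1) + δ (n + 1) ^ q)
    (hlim : Tendsto (fun n => θ ^ (n + 1) * δ n) atTop (𝓝 0)) (n : ℕ) : δ n = 0 := by
  have hθ0 : 0 < ‖θ‖ := by positivity
  have key : ∀ ε : ℝ, 0 < ε → ε ≤ 1 → ‖θ ^ (n + 1) * δ n‖ ≤ ε := by
    intro ε h0 h1
    have hev : ∀ᶠ N in atTop, ‖θ ^ (N + 1) * δ N‖ < ε :=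
      (tendsto_zero_iff_norm_tendsto_zero.1 hlim).eventually (gt_mem_nhds h0)
    obtain ⟨N, hN, hNn⟩ := (hev.and (eventually_ge_atTop n)).exists
    refine Nat.decreasingInduction' (P := fun m => ‖θ ^ (m + 1) * δ m‖ ≤ ε)
      (fun m _ _ hm => ?_) hNn hN.le
    have hm' : ‖δ (m + 1)‖ ≤ 1 := by
      rw [norm_mul, norm_pow] at hm
      exact (le_mul_of_one_le_left (norm_nonneg _) (one_le_pow₀ hθ.le)).trans (hm.trans h1)
    rw [hδ m, mul_add, ← mul_assoc, ← pow_succ]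
    refine (IsUltrametricDist.norm_add_le_max _ _).trans (max_le hm ?_)
    refine le_trans ?_ hm
    rw [norm_mul, norm_mul, norm_pow, norm_pow, norm_pow]
    exact mul_le_mul (pow_le_pow_right₀ hθ.le (by omega))
      (pow_le_of_le_one (norm_nonneg _) hm' (by omega)) (by positivity) (by positivity)
  have h0 : ‖θ ^ (n + 1) * δ n‖ ≤ 0 := by
    by_contra hpos
    push Not at hpos
    -- Half the norm as `ε` contradicts positivity; the minimum with `1` meets the side condition of
    -- `key`.
    have h2 := key (min 1 (‖θ ^ (n + 1) * δ n‖ / 2))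
      (lt_min one_pos (by positivity)) (min_le_left _ _)
    have h3 := h2.trans (min_le_right _ _)
    linarith
  have h4 := norm_le_zero_iff.1 h0
  exact (mul_eq_zero.1 h4).resolve_left (pow_ne_zero _ (norm_pos_iff.1 hθ0))

/-- Both sides satisfy the same additive recursion and become `ϖ` in the limit after scaling by
`θ^(n+1)`, so their difference vanishes. -/
theorem expSeries_period_div (hθ : 1 < ‖θ‖) (hq : 1 < q) (φ : L →+* L) (hφ : ∀ x, φ x = x ^ q)
    (hs : s ^ (q - 1) = -θ) (hs0 : s ≠ 0) (n : ℕ) :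
    expSeries q θ (period q θ s * (θ ^ (n + 1))⁻¹) = coeff n (twistInv q θ s) := by
  have hθ0 : θ ≠ 0 := norm_pos_iff.1 (by positivity)
  have h : ∀ n, expSeries q θ (period q θ s * (θ ^ (n + 1))⁻¹) - coeff n (twistInv q θ s) = 0 := by
    refine eq_zero_of_tendsto_pow_mul hθ hq (fun n => ?_) ?_
    · have h1 : period q θ s * (θ ^ (n + 1))⁻¹ = θ * (period q θ s * (θ ^ (n + 1 + 1))⁻¹) := by
        rw [pow_succ θ (n + 1)]
        have := pow_ne_zero (n + 1) hθ0
        field_simp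
      have h2 := pow_pow_sub φ hφ (expSeries q θ (period q θ s * (θ ^ (n + 1 + 1))⁻¹))
        (coeff (n + 1) (twistInv q θ s)) 1
      rw [pow_one] at h2
      rw [h1, expSeries_theta_mul hθ hq φ hφ, coeff_succ_twistInv hθ hq φ hφ hs hs0 n, h2]
      ring
    · have h1 := (tendsto_pow_mul_expSeries hθ hq (period q θ s)).sub
        (tendsto_coeff_twistInv hθ hq φ hφ hs hs0)
      rw [sub_self] at h1
      simpa only [mul_sub] using h1
  exact sub_eq_zero.1 (h n)

/-- The value at `ϖ/θ` is `λ_0 = s`, which the Carlitz action of `θ` kills: `θ s + s^q = 0`. -/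
theorem expSeries_period (hθ : 1 < ‖θ‖) (hq : 1 < q) (φ : L →+* L) (hφ : ∀ x, φ x = x ^ q)
    (hs : s ^ (q - 1) = -θ) (hs0 : s ≠ 0) : expSeries q θ (period q θ s) = 0 := by
  have hθ0 : θ ≠ 0 := norm_pos_iff.1 (by positivity)
  have h1 : period q θ s = θ * (period q θ s * (θ ^ (0 + 1))⁻¹) := by
    rw [zero_add, pow_one]; field_simp
  rw [h1, expSeries_theta_mul hθ hq φ hφ, expSeries_period_div hθ hq φ hφ hs hs0,
    coeff_zero_twistInv hθ hq, pow_eq_neg_mul hq hs, add_neg_cancel]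

theorem expSeries_pow_mul_period (hθ : 1 < ‖θ‖) (hq : 1 < q) (φ : L →+* L)
    (hφ : ∀ x, φ x = x ^ q) (hs : s ^ (q - 1) = -θ) (hs0 : s ≠ 0) (n : ℕ) :
    expSeries q θ (θ ^ n * period q θ s) = 0 := by
  induction n with
  | zero => rw [pow_zero, one_mul, expSeries_period hθ hq φ hφ hs hs0]
  | succ n ih =>
    rw [pow_succ', mul_assoc, expSeries_theta_mul hθ hq φ hφ, ih, mul_zero, zero_add,
      zero_pow (by omega)]

end Period

/-! ### The pairing of the `α_k` with a sequence -/

section Pairing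

open PowerSeries Filter Topology

variable {L : Type*} [NormedField L] {q : ℕ} {θ s : L}

/-- The series `∑_k α_k^(q^m) g_k^(q^n)`, where the `α_k` are the coefficients of `twist q θ s`. -/
def pairing (q : ℕ) (θ s : L) (m n : ℕ) (g : ℕ → L) : L :=
  ∑' k, coeff k (twist q θ s) ^ q ^ m * g k ^ q ^ n

/-- The sequence `λ_j, λ_{j-1}, …, λ_0, 0, 0, …`, where `∑_j λ_j X^j` is the inverse
of the power series `twist q θ s`. -/
def twistInvSeq (q : ℕ) (θ s : L) (j k : ℕ) : L :=
  if k ≤ j then coeff (j - k) (twistInv q θ s) else 0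

variable [IsUltrametricDist L] [CompleteSpace L]

theorem summable_norm_coeff_twist_pow (hθ : 1 < ‖θ‖) (hq : 1 < q) (m : ℕ) :
    Summable fun k => ‖coeff k (twist q θ s) ^ q ^ m‖ := by
  have hρ : ‖θ‖⁻¹ < 1 := inv_lt_one_of_one_lt₀ hθ
  have h1 : q ^ m ≠ 0 := (pow_pos (by omega) m).ne'
  refine Summable.of_nonneg_of_le (fun _ => norm_nonneg _) (fun k => ?_)
    ((summable_geometric_of_lt_one (by positivity) hρ).mul_left (‖s‖⁻¹ ^ q ^ m))
  rw [norm_pow]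
  calc _ ≤ (‖s‖⁻¹ * ‖θ‖⁻¹ ^ k) ^ q ^ m := by gcongr; exact norm_coeff_twist_le hθ hq k
    _ ≤ ‖s‖⁻¹ ^ q ^ m * ‖θ‖⁻¹ ^ k := by
      rw [mul_pow]
      gcongr
      exact pow_le_of_le_one (by positivity) (pow_le_one₀ (by positivity) hρ.le) h1

theorem summable_pairing (hθ : 1 < ‖θ‖) (hq : 1 < q) (m n : ℕ) {g : ℕ → L} {B : ℝ}
    (hg : ∀ k, ‖g k‖ ≤ B) :
    Summable fun k => coeff k (twist q θ s) ^ q ^ m * g k ^ q ^ n := by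
  refine Summable.of_norm_bounded
    ((summable_norm_coeff_twist_pow (s := s) hθ hq m).mul_right (B ^ q ^ n)) fun k => ?_
  rw [norm_mul, norm_pow (g k)]
  gcongr
  exact hg k

/-- The shift is moved onto the `α_k` through their recursion; the boundary term at `k = 0` cancels
by `coeff_zero_twist_eq`. -/
theorem pairing_shift_left (hθ : 1 < ‖θ‖) (hq : 1 < q) (φ : L →+* L) (hφ : ∀ x, φ x = x ^ q)
    (hs : s ^ (q - 1) = -θ) (hs0 : s ≠ 0) (m n : ℕ) {g : ℕ → L} {B : ℝ} (hg : ∀ k, ‖g k‖ ≤ B) :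
    pairing q θ s (m + 1) n (fun k => g (k + 1)) =
      pairing q θ s m n g + θ ^ q ^ m * pairing q θ s (m + 1) n g := by
  have h1 : ∀ k, coeff k (twist q θ s) ^ q ^ (m + 1) =
      coeff (k + 1) (twist q θ s) ^ q ^ m +
        θ ^ q ^ m * coeff (k + 1) (twist q θ s) ^ q ^ (m + 1) := fun k => by
    have h := coeff_succ_twist hθ hq φ hφ hs hs0 k
    rw [pow_succ', pow_mul, pow_mul, ← mul_pow, ← pow_pow_add φ hφ, ← eq_sub_iff_add_eq.1 h]
  have h0 : coeff 0 (twist q θ s) ^ q ^ m = -(θ ^ q ^ m * coeff 0 (twist q θ s) ^ q ^ (m + 1)) := by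
    conv_lhs => rw [coeff_zero_twist_eq hθ hq φ hφ hs hs0]
    rw [pow_pow_neg φ hφ, mul_pow, pow_succ', pow_mul]
  have s1 := summable_pairing (s := s) hθ hq m n hg
  have s2 := summable_pairing (s := s) hθ hq (m + 1) n hg
  have t1 := s1.tsum_eq_zero_add
  have t2 := s2.tsum_eq_zero_add
  have s1' := (summable_nat_add_iff 1).2 s1
  have s2' := (summable_nat_add_iff 1).2 s2
  have t3 : pairing q θ s (m + 1) n (fun k => g (k + 1)) =
      ∑' k, coeff (k + 1) (twist q θ s) ^ q ^ m * g (k + 1) ^ q ^ n +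
      θ ^ q ^ m * ∑' k, coeff (k + 1) (twist q θ s) ^ q ^ (m + 1) * g (k + 1) ^ q ^ n := by
    rw [← tsum_mul_left, ← s1'.tsum_add (s2'.mul_left _), pairing]
    exact tsum_congr fun k => by rw [h1 k]; ring
  rw [t3, pairing, pairing]
  linear_combination -t1 - θ ^ q ^ m * t2 - g 0 ^ q ^ n * h0

theorem pairing_shift_right (hθ : 1 < ‖θ‖) (hq : 1 < q) (φ : L →+* L) (hφ : ∀ x, φ x = x ^ q)
    (m n : ℕ) {g : ℕ → L} {B : ℝ} (hg : ∀ k, ‖g k‖ ≤ B)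
    (hrec : ∀ k, g (k + 1) = θ * g k + g k ^ q) :
    pairing q θ s m n (fun k => g (k + 1)) =
      θ ^ q ^ n * pairing q θ s m n g + pairing q θ s m (n + 1) g := by
  rw [pairing, pairing, pairing, ← tsum_mul_left,
    ← ((summable_pairing (s := s) hθ hq m n hg).mul_left _).tsum_add
      (summable_pairing (s := s) hθ hq m (n + 1) hg)]
  exact tsum_congr fun k => by
    rw [hrec, pow_pow_add φ hφ, mul_pow, pow_succ', pow_mul (g k)]; ring

theorem pairing_succ_succ (hθ : 1 < ‖θ‖) (hq : 1 < q) (φ : L →+* L) (hφ : ∀ x, φ x = x ^ q)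
    (m n : ℕ) {g : ℕ → L} {B : ℝ} (hg : ∀ k, ‖g k‖ ≤ B) :
    pairing q θ s (m + 1) (n + 1) g = pairing q θ s m n g ^ q := by
  rw [pairing, pairing, ← hφ,
    ((summable_pairing hθ hq m n hg).map_tsum φ (continuous_of_pow φ hφ))]
  exact tsum_congr fun k => by
    rw [hφ, mul_pow, pow_succ, pow_succ, pow_mul, pow_mul]

/-- Equate the two values of the pairing with the shifted sequence; a common Frobenius power comes
out of `P_{m+1,1}`. -/
theorem pairing_succ_mul (hθ : 1 < ‖θ‖) (hq : 1 < q) (φ : L →+* L) (hφ : ∀ x, φ x = x ^ q)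
    (hs : s ^ (q - 1) = -θ) (hs0 : s ≠ 0) (m : ℕ) {g : ℕ → L} {B : ℝ} (hg : ∀ k, ‖g k‖ ≤ B)
    (hrec : ∀ k, g (k + 1) = θ * g k + g k ^ q) :
    (θ ^ q ^ m - θ) * pairing q θ s (m + 1) 0 g =
      pairing q θ s m 0 g ^ q - pairing q θ s m 0 g := by
  have h1 := pairing_shift_left hθ hq φ hφ hs hs0 m 0 hg
  have h2 := pairing_shift_right (s := s) hθ hq φ hφ (m + 1) 0 hg hrec
  rw [pairing_succ_succ hθ hq φ hφ m 0 hg, pow_zero, pow_one] at h2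
  linear_combination h2 - h1

theorem norm_twistInvSeq_le (hθ : 1 < ‖θ‖) (hq : 1 < q) (j k : ℕ) :
    ‖twistInvSeq q θ s j k‖ ≤ ‖s‖ := by
  rw [twistInvSeq]
  split_ifs
  · exact (norm_coeff_twistInv_le hθ hq _).trans <| mul_le_of_le_one_right (norm_nonneg _) <|
      pow_le_one₀ (by positivity) (inv_le_one_of_one_le₀ hθ.le)
  · simp

-- The pairing is the coefficient of `X^j` in the product of `twist` with its inverse.
omit [IsUltrametricDist L] in
theorem pairing_zero_twistInvSeq (hθ : 1 < ‖θ‖) (hq : 1 < q) (hs0 : s ≠ 0) (j : ℕ) :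
    pairing q θ s 0 0 (twistInvSeq q θ s j) = if j = 0 then 1 else 0 := by
  have h := congrArg (coeff j) (twist_mul_twistInv hθ hq hs0)
  rw [coeff_one, coeff_mul, Finset.Nat.sum_antidiagonal_eq_sum_range_succ_mk] at h
  rw [← h, pairing, tsum_eq_sum (s := Finset.range j.succ)]
  · refine Finset.sum_congr rfl fun k hk => ?_
    rw [twistInvSeq, if_pos (Nat.lt_succ_iff.1 (Finset.mem_range.1 hk)), pow_zero, pow_one, pow_one]
  · intro k hk
    rw [twistInvSeq, if_neg (by simpa [Nat.lt_succ_iff] using hk)]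
    simp

/-- Shifting lowers `j` by one, and to zero when `j = 0`, so `pairing_shift_left` becomes a
recursion with ratio `θ⁻¹`. -/
theorem pairing_one_twistInvSeq (hθ : 1 < ‖θ‖) (hq : 1 < q) (φ : L →+* L)
    (hφ : ∀ x, φ x = x ^ q) (hs : s ^ (q - 1) = -θ) (hs0 : s ≠ 0) (j : ℕ) :
    pairing q θ s 1 0 (twistInvSeq q θ s j) = -(θ ^ (j + 1))⁻¹ := by
  have hθ0 : θ ≠ 0 := norm_pos_iff.1 (by positivity)
  induction j with
  | zero =>
    have h := pairing_shift_left hθ hq φ hφ hs hs0 0 0 (norm_twistInvSeq_le (s := s) hθ hq 0)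
    rw [pairing_zero_twistInvSeq hθ hq hs0, if_pos rfl, zero_add] at h
    have h1 : pairing q θ s 1 0 (fun k => twistInvSeq q θ s 0 (k + 1)) = 0 := by
      simp [pairing, twistInvSeq]
    rw [h1, pow_zero, pow_one] at h
    rw [zero_add, pow_one]
    field_simp
    linear_combination -h
  | succ j ih =>
    have h := pairing_shift_left hθ hq φ hφ hs hs0 0 0 (norm_twistInvSeq_le (s := s) hθ hq (j + 1))
    have h1 : (fun k => twistInvSeq q θ s (j + 1) (k + 1)) = twistInvSeq q θ s j := by
      ext k; simp [twistInvSeq]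
    rw [h1, zero_add, ih, pairing_zero_twistInvSeq hθ hq hs0, if_neg (by omega), pow_zero,
      pow_one, zero_add] at h
    rw [pow_succ, mul_inv, ← neg_mul, h]
    field_simp

end Pairing

/-! ### The recursion for `Ψ_N` -/

section Psi

variable {F K : Type*} [Field F] [Fintype F] [Field K] [Algebra F K]

/-- The `F`-linear maps given by `ψ_0(z) = z` and
`(t^(q^(n+1)) - t) ψ_(n+1)(z) = ψ_n(z)^q - ψ_n(z)`. -/
def psi (F : Type*) [Field F] [Fintype F] {K : Type*} [Field K] [Algebra F K] (t : K) :
    ℕ → K →ₗ[F] K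
  | 0 => LinearMap.id
  | n + 1 => (t ^ Fintype.card F ^ (n + 1) - t)⁻¹ •
      ((FiniteField.frobeniusAlgHom F K).toLinearMap ∘ₗ psi F t n - psi F t n)

variable {t : K}

local notation "q" => Fintype.card F

theorem psi_zero (z : K) : psi F t 0 z = z := rfl

theorem psi_succ (n : ℕ) (z : K) :
    psi F t (n + 1) z = (t ^ q ^ (n + 1) - t)⁻¹ * (psi F t n z ^ q - psi F t n z) := rfl

theorem mul_psi_succ (ht : ∀ n, t ^ q ^ (n + 1) - t ≠ 0) (n : ℕ) (z : K) :
    (t ^ q ^ (n + 1) - t) * psi F t (n + 1) z = psi F t n z ^ q - psi F t n z := by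
  rw [psi_succ, mul_inv_cancel_left₀ (ht n)]

theorem add_pow_card_eq (x y : K) : (x + y) ^ q = x ^ q + y ^ q :=
  map_add (FiniteField.frobeniusAlgHom F K) x y

theorem sub_pow_card_eq (x y : K) : (x - y) ^ q = x ^ q - y ^ q :=
  map_sub (FiniteField.frobeniusAlgHom F K) x y

/-- This is what lets induction on the exponent show that `ψ_n` kills `t^j` for `j < n` and is `1`
at `t^n`. -/
theorem psi_succ_mul (ht : ∀ n, t ^ q ^ (n + 1) - t ≠ 0) (n : ℕ) (z : K) :
    psi F t (n + 1) (t * z) = t * psi F t (n + 1) z + psi F t n z ^ q := by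
  induction n with
  | zero =>
    refine mul_left_cancel₀ (ht 0) ?_
    rw [mul_add, mul_left_comm, mul_psi_succ ht, mul_psi_succ ht]
    simp only [psi_zero, zero_add, pow_one]
    ring
  | succ n ih =>
    refine mul_left_cancel₀ (ht (n + 1)) ?_
    rw [mul_add, mul_left_comm, mul_psi_succ ht, mul_psi_succ ht, ih, add_pow_card_eq, mul_pow]
    have h1 := congrArg (· ^ q) (mul_psi_succ ht n z)
    simp only [mul_pow, sub_pow_card_eq] at h1
    rw [← pow_mul, ← pow_succ] at h1
    linear_combination -h1

theorem psi_pow_eq_zero (ht : ∀ n, t ^ q ^ (n + 1) - t ≠ 0) {n j : ℕ} (h : j < n) :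
    psi F t n (t ^ j) = 0 := by
  have hq : q ≠ 0 := Fintype.card_ne_zero
  induction j generalizing n with
  | zero =>
    obtain ⟨m, rfl⟩ := Nat.exists_eq_succ_of_ne_zero h.ne'
    clear h
    induction m with
    | zero => simp [psi_succ, psi_zero]
    | succ m ih => rw [Nat.succ_eq_add_one, psi_succ, ih, zero_pow hq, sub_zero, mul_zero]
  | succ j ih =>
    obtain ⟨m, rfl⟩ := Nat.exists_eq_succ_of_ne_zero (Nat.ne_zero_of_lt h)
    rw [Nat.succ_eq_add_one, pow_succ', psi_succ_mul ht, ih (by omega), ih (by omega), mul_zero,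
      zero_pow hq, add_zero]

theorem psi_pow_self (ht : ∀ n, t ^ q ^ (n + 1) - t ≠ 0) (n : ℕ) : psi F t n (t ^ n) = 1 := by
  induction n with
  | zero => rw [psi_zero, pow_zero]
  | succ n ih =>
    rw [pow_succ', psi_succ_mul ht, psi_pow_eq_zero ht (Nat.lt_succ_self n), ih, mul_zero,
      one_pow, zero_add]

/-- The product of `z - ∑_{i<n} v_i t^i` over all `v`. -/
def prodSub (F : Type*) [Field F] [Fintype F] {K : Type*} [Field K] [Algebra F K] (t : K) (n : ℕ)
    (z : K) : K := by
  classical exact ∏ v : Fin n → F, (z - ∑ i, algebraMap F K (v i) * t ^ (i : ℕ))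

theorem prod_sub_algebraMap (y : K) : ∏ c : F, (y - algebraMap F K c) = y ^ q - y := by
  have hq : 1 < q := Fintype.one_lt_card
  have h := Polynomial.prod_multiset_X_sub_C_of_monic_of_roots_card_eq
    (p := (Polynomial.X ^ q - Polynomial.X : F[X]))
    (Polynomial.monic_X_pow_sub (by simpa using hq))
    (by
      rw [FiniteField.roots_X_pow_card_sub_X, FiniteField.X_pow_card_sub_X_natDegree_eq F hq]
      rfl)
  rw [FiniteField.roots_X_pow_card_sub_X] at h
  simpa [map_prod] using congrArg (Polynomial.aeval y) h

theorem prodSub_succ (n : ℕ) (z : K) :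
    prodSub F t (n + 1) z = ∏ c : F, prodSub F t n (z - algebraMap F K c * t ^ n) := by
  classical
  rw [prodSub, ← (Fin.snocEquiv fun _ => F).prod_comp, Fintype.prod_prod_type]
  refine Finset.prod_congr rfl fun c _ => Finset.prod_congr rfl fun v _ => ?_
  rw [Fin.sum_univ_castSucc]
  simp [Fin.snocEquiv]
  ring

/-- Grouping by the top coefficient `c`, linearity and `ψ_n(t^n) = 1` give factors `ψ_n(z) - c`, and
`∏_c (y - c) = y^q - y` reproduces the recursion. The constant `D` stays implicit since only a
quotient of two values is needed. -/
theorem exists_prodSub_eq (ht : ∀ n, t ^ q ^ (n + 1) - t ≠ 0) (n : ℕ) :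
    ∃ D : K, D ≠ 0 ∧ ∀ z, prodSub F t n z = D * psi F t n z := by
  induction n with
  | zero => exact ⟨1, one_ne_zero, fun z => by simp [prodSub, psi_zero]⟩
  | succ n ih =>
    obtain ⟨D, hD, h⟩ := ih
    refine ⟨D ^ q * (t ^ q ^ (n + 1) - t), mul_ne_zero (pow_ne_zero _ hD) (ht n), fun z => ?_⟩
    have h1 : ∀ c : F, psi F t n (z - algebraMap F K c * t ^ n) =
        psi F t n z - algebraMap F K c := fun c => by
      rw [map_sub, ← Algebra.smul_def, map_smul, psi_pow_self ht, Algebra.smul_def, mul_one]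
    rw [prodSub_succ, mul_assoc, mul_psi_succ ht, ← prod_sub_algebraMap]
    simp_rw [h, h1]
    rw [Finset.prod_mul_distrib, Finset.prod_const, Finset.card_univ]

theorem prodSub_div_prodSub (ht : ∀ n, t ^ q ^ (n + 1) - t ≠ 0) (n : ℕ) (z : K) :
    prodSub F t n z / prodSub F t n (t ^ n) = psi F t n z := by
  obtain ⟨D, hD, h⟩ := exists_prodSub_eq ht n
  rw [h, h, psi_pow_self ht, mul_one, mul_div_cancel_left₀ _ hD]

open Polynomial in
theorem bijOn_sum_monomial (F : Type*) [Field F] (n : ℕ) :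
    Set.BijOn (fun v : Fin n → F => ∑ i, C (v i) * X ^ (i : ℕ)) Set.univ
      {a : F[X] | a.degree < (n : WithBot ℕ)} := by
  have hco : ∀ (v : Fin n → F) (i : Fin n), (∑ i, C (v i) * X ^ (i : ℕ)).coeff i = v i := by
    intro v i
    simp [finsetSum_coeff, coeff_X_pow, Fin.val_inj]
  refine ⟨fun v _ => degree_sum_fin_lt v, fun v _ w _ h => ?_, fun a ha => ?_⟩
  · ext i
    rw [← hco v i, ← hco w i]
    exact congrArg (coeff · i) h
  · refine ⟨fun i => a.coeff i, trivial, ?_⟩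
    change ∑ i : Fin n, C (a.coeff i) * X ^ (i : ℕ) = a
    rw [Fin.sum_univ_eq_sum_range (fun i => C (a.coeff i) * X ^ i)]
    by_cases h0 : a = 0
    · simp [h0]
    · exact (as_sum_range_C_mul_X_pow' a ((natDegree_lt_iff_degree_lt h0).2 ha)).symm

-- It exhibits the denominator of `Ψ_n` as its numerator evaluated at `t^n`.
open Polynomial in
theorem bijOn_X_pow_sub (F : Type*) [Field F] (n : ℕ) :
    Set.BijOn (fun a : F[X] => X ^ n - a) {a : F[X] | a.degree < (n : WithBot ℕ)}
      {a : F[X] | a.Monic ∧ a.degree = (n : WithBot ℕ)} := by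
  refine ⟨fun a ha => ⟨?_, ?_⟩, fun a _ b _ h => sub_right_injective h, fun a ha => ?_⟩
  · exact monic_X_pow_sub ha
  · rw [degree_sub_eq_left_of_degree_lt (by rwa [degree_X_pow]), degree_X_pow]
  · refine ⟨X ^ n - a, ?_, sub_sub_cancel _ _⟩
    have h1 : (X ^ n : F[X]).degree = a.degree := by rw [degree_X_pow, ha.2]
    have h2 := degree_sub_lt_left h1 (monic_X_pow n).ne_zero (by rw [ha.1, monic_X_pow n])
    rwa [degree_X_pow] at h2

open Polynomial in
theorem finprod_degree_lt (n : ℕ) (z : K) :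
    ∏ᶠ (a : F[X]) (_ : a.degree < (n : WithBot ℕ)), (z - aeval t a) = prodSub F t n z := by
  classical
  have h := finprod_mem_eq_of_bijOn
    (f := fun v : Fin n → F => z - ∑ i, algebraMap F K (v i) * t ^ (i : ℕ))
    (g := fun a : F[X] => z - aeval t a) _ (bijOn_sum_monomial F n) fun v _ => by simp
  rw [finprod_mem_univ, finprod_eq_prod_of_fintype] at h
  rw [prodSub]
  exact h.symm

open Polynomial in
theorem finprod_monic (n : ℕ) :
    ∏ᶠ (a : F[X]) (_ : a.Monic ∧ a.degree = (n : WithBot ℕ)), aeval t a =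
      prodSub F t n (t ^ n) := by
  rw [← finprod_degree_lt]
  exact (finprod_mem_eq_of_bijOn (f := fun a : F[X] => t ^ n - aeval t a)
    (g := fun a : F[X] => aeval t a) _ (bijOn_X_pow_sub F n) fun v _ => by simp).symm

end Psi

/-! ### Coefficients of Laurent series in `1/T` and of fractions -/

section LaurentSeries

variable {Fq : Type*} [Field Fq]

theorem varK_eq_single : varK Fq = HahnSeries.single (-1) 1 := by simp [varK, polyToKInfty]

theorem varK_ne_zero : varK Fq ≠ 0 := by
  rw [varK_eq_single]; exact HahnSeries.single_ne_zero one_ne_zero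

theorem varK_pow (n : ℕ) : varK Fq ^ n = HahnSeries.single (-(n : ℤ)) 1 := by
  rw [varK_eq_single, HahnSeries.single_pow, one_pow]; simp

theorem varK_pow_inv (n : ℕ) : (varK Fq ^ n)⁻¹ = HahnSeries.single (n : ℤ) 1 := by
  refine inv_eq_of_mul_eq_one_right ?_
  rw [varK_pow, HahnSeries.single_mul_single]; simp

theorem coeff_varK_pow_mul (n : ℕ) (x : KInfty Fq) (i : ℤ) :
    (varK Fq ^ n * x).coeff i = x.coeff (i + n) := by
  rw [varK_pow, HahnSeries.coeff_single_mul, one_mul, sub_neg_eq_add]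

theorem res_varK_pow_mul (n : ℕ) (x : KInfty Fq) :
    res Fq (varK Fq ^ n * x) = x.coeff (n + 1) := by
  rw [res, coeff_varK_pow_mul, add_comm]

theorem res_add (x y : KInfty Fq) : res Fq (x + y) = res Fq x + res Fq y := rfl

theorem algebraMap_mul_single (c : Fq) (i : ℤ) :
    algebraMap Fq (KInfty Fq) c * HahnSeries.single i 1 = HahnSeries.single i c := by
  rw [LaurentSeries.algebraMap_apply, HahnSeries.C_apply, HahnSeries.single_mul_single, zero_add,
    mul_one]

theorem coeff_algebraMap_mul (c : Fq) (x : KInfty Fq) (i : ℤ) :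
    (algebraMap Fq (KInfty Fq) c * x).coeff i = c * x.coeff i := by
  rw [LaurentSeries.algebraMap_apply, HahnSeries.C_apply, HahnSeries.coeff_single_mul, sub_zero]

theorem polyToKInfty_C (c : Fq) :
    polyToKInfty Fq (Polynomial.C c) = algebraMap Fq (KInfty Fq) c := by
  simp [polyToKInfty]

theorem polyToKInfty_X : polyToKInfty Fq Polynomial.X = varK Fq := rfl

theorem polyToKInfty_monomial (m : ℕ) (c : Fq) :
    polyToKInfty Fq (Polynomial.monomial m c) = HahnSeries.single (-(m : ℤ)) c := by
  rw [← Polynomial.C_mul_X_pow_eq_monomial, map_mul, map_pow, polyToKInfty_C, polyToKInfty_X,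
    varK_pow, algebraMap_mul_single]

theorem coeff_polyToKInfty_neg (p : Fq[X]) (n : ℕ) :
    (polyToKInfty Fq p).coeff (-(n : ℤ)) = p.coeff n := by
  induction p using Polynomial.induction_on' with
  | add p r hp hr => rw [map_add, HahnSeries.coeff_add, hp, hr, Polynomial.coeff_add]
  | monomial m c =>
    rw [polyToKInfty_monomial, HahnSeries.coeff_single, Polynomial.coeff_monomial]
    simp [eq_comm]

theorem coeff_polyToKInfty_of_pos (p : Fq[X]) {i : ℤ} (hi : 0 < i) :
    (polyToKInfty Fq p).coeff i = 0 := by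
  induction p using Polynomial.induction_on' with
  | add p r hp hr => rw [map_add, HahnSeries.coeff_add, hp, hr, add_zero]
  | monomial m c =>
    rw [polyToKInfty_monomial, HahnSeries.coeff_single, if_neg (by omega)]

theorem polyToKInfty_injective : Function.Injective (polyToKInfty Fq) := fun p r h => by
  ext n
  rw [← coeff_polyToKInfty_neg, h, coeff_polyToKInfty_neg]

theorem polyToKInfty_ne_zero {p : Fq[X]} (hp : p ≠ 0) : polyToKInfty Fq p ≠ 0 :=
  (map_ne_zero_iff _ polyToKInfty_injective).2 hp

theorem res_polyToKInfty (p : Fq[X]) : res Fq (polyToKInfty Fq p) = 0 :=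
  coeff_polyToKInfty_of_pos p one_pos

theorem order_polyToKInfty {p : Fq[X]} (hp : p ≠ 0) :
    (polyToKInfty Fq p).order = -(p.natDegree : ℤ) := by
  refine le_antisymm (HahnSeries.order_le_of_coeff_ne_zero ?_)
    ((HahnSeries.le_order_iff_forall (polyToKInfty_ne_zero hp)).2 fun i hi => ?_)
  · rw [coeff_polyToKInfty_neg]
    exact Polynomial.leadingCoeff_ne_zero.2 hp
  · obtain ⟨n, rfl⟩ : ∃ n : ℕ, i = -(n : ℤ) := ⟨(-i).toNat, by omega⟩
    rw [coeff_polyToKInfty_neg]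
    exact Polynomial.coeff_eq_zero_of_natDegree_lt (by omega)

theorem leadingCoeff_polyToKInfty (p : Fq[X]) :
    (polyToKInfty Fq p).leadingCoeff = p.leadingCoeff := by
  by_cases hp : p = 0
  · simp [hp]
  · rw [HahnSeries.leadingCoeff_eq, order_polyToKInfty hp, coeff_polyToKInfty_neg]; rfl

theorem frac_mul_self {f : Fq[X]} (hf : f ≠ 0) (a : Fq[X]) :
    frac Fq a f * polyToKInfty Fq f = polyToKInfty Fq a :=
  div_mul_cancel₀ _ (polyToKInfty_ne_zero hf)

theorem frac_mul_left (a b f : Fq[X]) :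
    frac Fq (a * b) f = polyToKInfty Fq a * frac Fq b f := by
  rw [frac, frac, map_mul, mul_div_assoc]

theorem frac_add (a b f : Fq[X]) : frac Fq (a + b) f = frac Fq a f + frac Fq b f := by
  rw [frac, frac, frac, map_add, add_div]

theorem frac_mul_denom {f : Fq[X]} (hf : f ≠ 0) (a : Fq[X]) :
    frac Fq (f * a) f = polyToKInfty Fq a := by
  rw [frac, map_mul, mul_div_cancel_left₀ _ (polyToKInfty_ne_zero hf)]

theorem frac_ne_zero {a f : Fq[X]} (ha : a ≠ 0) (hf : f ≠ 0) : frac Fq a f ≠ 0 :=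
  div_ne_zero (polyToKInfty_ne_zero ha) (polyToKInfty_ne_zero hf)

theorem order_frac {a f : Fq[X]} (ha : a ≠ 0) (hf : f ≠ 0) :
    (frac Fq a f).order = (f.natDegree : ℤ) - a.natDegree := by
  have h := congrArg HahnSeries.order (frac_mul_self hf a)
  rw [HahnSeries.order_mul (frac_ne_zero ha hf) (polyToKInfty_ne_zero hf), order_polyToKInfty hf,
    order_polyToKInfty ha] at h
  omega

theorem leadingCoeff_frac {a f : Fq[X]} (hf : f.Monic) :
    (frac Fq a f).leadingCoeff = a.leadingCoeff := by
  have h := congrArg HahnSeries.leadingCoeff (frac_mul_self hf.ne_zero a)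
  rwa [HahnSeries.leadingCoeff_mul, leadingCoeff_polyToKInfty, leadingCoeff_polyToKInfty,
    hf.leadingCoeff, mul_one] at h

theorem coeff_frac_eq_zero {a f : Fq[X]} (hf : f ≠ 0) {i : ℤ}
    (hi : i < (f.natDegree : ℤ) - a.natDegree) : (frac Fq a f).coeff i = 0 := by
  by_cases ha : a = 0
  · simp [frac, ha]
  · exact HahnSeries.coeff_eq_zero_of_lt_order (by rwa [order_frac ha hf])

theorem coeff_frac_eq_leadingCoeff {a f : Fq[X]} (ha : a ≠ 0) (hf : f.Monic) :
    (frac Fq a f).coeff ((f.natDegree : ℤ) - a.natDegree) = a.leadingCoeff := by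
  rw [← leadingCoeff_frac hf, HahnSeries.leadingCoeff_eq, order_frac ha hf.ne_zero]

theorem coeff_frac_of_degree_lt {a f : Fq[X]} (h : a.degree < f.degree) {i : ℤ} (hi : i ≤ 0) :
    (frac Fq a f).coeff i = 0 := by
  by_cases ha : a = 0
  · simp [frac, ha]
  · have := Polynomial.natDegree_lt_natDegree ha h
    exact coeff_frac_eq_zero (Polynomial.ne_zero_of_degree_gt h) (by omega)

/-- Every Laurent series in `1/T` is a polynomial in `T` plus a series without
terms `T^i`, `i ≥ 0`. -/
theorem exists_poly_add (x : KInfty Fq) :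
    ∃ (p : Fq[X]) (y : KInfty Fq), x = polyToKInfty Fq p + y ∧ ∀ i ≤ 0, y.coeff i = 0 := by
  obtain ⟨N, hN⟩ : ∃ N : ℕ, -(N : ℤ) < x.order := ⟨(1 - x.order).toNat, by omega⟩
  refine ⟨∑ n ∈ Finset.range N, Polynomial.monomial n (x.coeff (-(n : ℤ))), _,
    (add_sub_cancel _ x).symm, fun i hi => ?_⟩
  obtain ⟨n, rfl⟩ : ∃ n : ℕ, i = -(n : ℤ) := ⟨(-i).toNat, by omega⟩
  rw [HahnSeries.coeff_sub, coeff_polyToKInfty_neg, Polynomial.finsetSum_coeff]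
  simp only [Polynomial.coeff_monomial, Finset.sum_ite_eq', Finset.mem_range]
  split_ifs with h
  · rw [sub_self]
  · rw [sub_zero]
    exact HahnSeries.coeff_eq_zero_of_lt_order (by omega)

/-! ### The residue pairing on `A / f` -/

/-- The functional `u ↦ Res(u g / f)`. -/
def resFrac (f g : Fq[X]) : Fq[X] →ₗ[Fq] Fq where
  toFun u := res Fq (frac Fq (u * g) f)
  map_add' u v := by rw [add_mul, frac_add, res_add]
  map_smul' c u := by
    rw [smul_mul_assoc, Polynomial.smul_eq_C_mul, frac_mul_left, polyToKInfty_C, res,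
      coeff_algebraMap_mul]
    rfl

theorem resFrac_apply (f g u : Fq[X]) : resFrac f g u = res Fq (frac Fq (u * g) f) := rfl

theorem resFrac_mul_denom {f : Fq[X]} (hf : f ≠ 0) (g u : Fq[X]) : resFrac f g (f * u) = 0 := by
  rw [resFrac_apply, mul_assoc, frac_mul_denom hf, res_polyToKInfty]

/-- Nondegeneracy of the residue pairing: a nonzero remainder `r` is detected by a suitable power of
`X`. -/
theorem dvd_of_resFrac_eq_zero {f : Fq[X]} (hf : f.Monic) {g : Fq[X]} (h : resFrac f g = 0) :
    f ∣ g := by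
  rw [← Polynomial.modByMonic_eq_zero_iff_dvd hf]
  by_contra hr
  set r := g %ₘ f with hr_def
  have hlt := Polynomial.natDegree_lt_natDegree hr (Polynomial.degree_modByMonic_lt g hf)
  -- With this `m` the leading term of `T^m r/f` sits at `T⁻¹`, so its residue is the leading
  -- coefficient of `r`.
  obtain ⟨m, hm⟩ : ∃ m : ℕ, (f.natDegree : ℤ) - r.natDegree = m + 1 :=
    ⟨f.natDegree - r.natDegree - 1, by omega⟩
  have h1 := LinearMap.congr_fun h (Polynomial.X ^ m)
  rw [resFrac_apply, ← Polynomial.modByMonic_add_div g f, mul_add, mul_left_comm, frac_add,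
    frac_mul_denom hf.ne_zero, res_add, res_polyToKInfty, add_zero, ← hr_def, frac_mul_left,
    map_pow, polyToKInfty_X, res_varK_pow_mul, ← hm, coeff_frac_eq_leadingCoeff hr hf] at h1
  exact hr (Polynomial.leadingCoeff_eq_zero.1 h1)

/-- Pairing a relation modulo `f` with `b_j` isolates its `j`-th coefficient, so the `a_i` are
independent; their number is the dimension of `A/f`. -/
theorem IsDualFamily.span_eq_top {f : Fq[X]} (hf : f.Monic) {a b : Fin f.natDegree → Fq[X]}
    (hab : IsDualFamily Fq f a b) :
    Submodule.span Fq (Set.range fun i => Ideal.Quotient.mkₐ Fq (Ideal.span {f}) (a i)) = ⊤ := by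
  have : FiniteDimensional Fq (Fq[X] ⧸ Ideal.span {f}) :=
    (AdjoinRoot.powerBasis hf.ne_zero).finite
  refine LinearIndependent.span_eq_top_of_card_eq_finrank' ?_
    (by rw [Fintype.card_fin, finrank_quotient_span_eq_natDegree])
  rw [Fintype.linearIndependent_iff]
  intro c hc j
  simp_rw [← map_smul, ← map_sum] at hc
  rw [Ideal.Quotient.mkₐ_eq_mk, Ideal.Quotient.eq_zero_iff_mem, Ideal.mem_span_singleton] at hc
  obtain ⟨u, hu⟩ := hc
  have h := congrArg (resFrac f (b j)) hu
  rw [resFrac_mul_denom hf.ne_zero, map_sum] at h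
  simpa [resFrac_apply, hab _ j] using h

theorem IsDualFamily.dvd_of_forall {f : Fq[X]} (hf : f.Monic) {a b : Fin f.natDegree → Fq[X]}
    (hab : IsDualFamily Fq f a b) {g : Fq[X]} (h : ∀ i, resFrac f g (a i) = 0) : f ∣ g := by
  refine dvd_of_resFrac_eq_zero hf (LinearMap.ext fun u => ?_)
  have hu : Ideal.Quotient.mkₐ Fq (Ideal.span {f}) u ∈
      Submodule.span Fq (Set.range fun i => Ideal.Quotient.mkₐ Fq (Ideal.span {f}) (a i)) := by
    rw [hab.span_eq_top hf]; trivial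
  obtain ⟨c, hc⟩ := (Submodule.mem_span_range_iff_exists_fun Fq).1 hu
  simp_rw [← map_smul, ← map_sum] at hc
  rw [Ideal.Quotient.mkₐ_eq_mk, Ideal.Quotient.eq, Ideal.mem_span_singleton] at hc
  obtain ⟨v, hv⟩ := hc
  have h1 : u = ∑ i, c i • a i - f * v := by rw [← hv]; ring
  rw [h1, map_sub, resFrac_mul_denom hf.ne_zero, map_sum, sub_zero]
  simp [h]

/-- Both terms of the difference pair equally with every `a_j`, and the `a_j` span modulo `f`. -/
theorem IsDualFamily.dvd_sub {f : Fq[X]} (hf : f.Monic) {a b : Fin f.natDegree → Fq[X]}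
    (hab : IsDualFamily Fq f a b) (g : Fq[X]) :
    f ∣ g - ∑ i, Polynomial.C (resFrac f g (a i)) * b i := by
  refine hab.dvd_of_forall hf fun j => ?_
  have h1 : ∀ g₁ g₂ : Fq[X], resFrac f (g₁ - g₂) (a j) = resFrac f g₁ (a j) - resFrac f g₂ (a j) :=
    fun g₁ g₂ => by
      rw [resFrac_apply, mul_comm, ← resFrac_apply, map_sub, resFrac_apply, resFrac_apply,
        mul_comm, mul_comm g₂]; rfl
  have h2 : resFrac f (∑ i, Polynomial.C (resFrac f g (a i)) * b i) (a j) =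
      resFrac f g (a j) := by
    rw [resFrac_apply, mul_comm, ← resFrac_apply]
    simp_rw [← Polynomial.smul_eq_C_mul]
    rw [map_sum]
    have h3 : ∀ i, resFrac f (a j) (b i) = if j = i then 1 else 0 := fun i => by
      rw [resFrac_apply, mul_comm, hab]
    simp [h3]
  rw [h1, h2, sub_self]

end LaurentSeries

/-! ### The function `e` on `k_∞` -/

section CInfty

variable {Fq : Type*} [Field Fq] [Fintype Fq]

open Filter Topology

local notation "q" => Fintype.card Fq

instance isUltrametricDistKInftyBar : IsUltrametricDist (KInftyBar Fq) :=
  IsUltrametricDist.isUltrametricDist_of_isNonarchimedean_norm isNonarchimedean_spectralNorm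

instance isUltrametricDistCInfty : IsUltrametricDist (CInfty Fq) := by
  refine IsUltrametricDist.isUltrametricDist_of_isNonarchimedean_norm fun x y => ?_
  induction x, y using UniformSpace.Completion.induction_on₂ with
  | hp => exact isClosed_le (by fun_prop) (by fun_prop)
  | ih x y =>
    rw [← UniformSpace.Completion.coe_add]
    simp only [UniformSpace.Completion.norm_coe]
    exact IsUltrametricDist.norm_add_le_max x y

/-- The `q`-power map on `ℂ_∞`. -/
def frobC (Fq : Type*) [Field Fq] [Fintype Fq] : CInfty Fq →+* CInfty Fq :=
  letI := ((toCInfty Fq).comp (algebraMap Fq (KInfty Fq))).toAlgebra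
  (FiniteField.frobeniusAlgHom Fq (CInfty Fq)).toRingHom

theorem frobC_apply (x : CInfty Fq) : frobC Fq x = x ^ q := rfl

theorem one_lt_q : 1 < q := Fintype.one_lt_card

theorem norm_toCInfty (x : KInfty Fq) : ‖toCInfty Fq x‖ = ‖x‖ := norm_algebraMap' _ _

theorem continuous_toCInfty : Continuous (toCInfty Fq) :=
  (AddMonoidHomClass.isometry_of_norm (toCInfty Fq) norm_toCInfty).continuous

theorem one_lt_norm_varK : 1 < ‖varK Fq‖ := by
  rw [Valued.toNormedField.one_lt_norm_iff, varK_eq_single, LaurentSeries.valuation_single_zpow,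
    ← WithZero.exp_zero, WithZero.exp_lt_exp]
  simp

theorem one_lt_norm_varC : 1 < ‖varC Fq‖ := by
  rw [varC, norm_toCInfty]; exact one_lt_norm_varK

theorem IsRootNegT.ne_zero {s : CInfty Fq} (hs : IsRootNegT Fq s) : s ≠ 0 := by
  rintro rfl
  have h1 : q - 1 ≠ 0 := by have := one_lt_q (Fq := Fq); omega
  have h2 : (0 : CInfty Fq) ^ (q - 1) = -varC Fq := hs
  rw [zero_pow h1, zero_eq_neg] at h2
  have h3 := one_lt_norm_varC (Fq := Fq)
  rw [h2, norm_zero] at h3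
  exact absurd h3 (by norm_num)

theorem norm_le_one_of_coeff {x : KInfty Fq} (hx : ∀ i ≤ 0, x.coeff i = 0) : ‖x‖ ≤ 1 := by
  rw [Valued.toNormedField.norm_le_one_iff, ← WithZero.exp_zero]
  have h := (LaurentSeries.valuation_le_iff_coeff_lt_eq_zero Fq (D := 0) (f := x)).2
    fun n hn => hx n hn.le
  rwa [neg_zero] at h

theorem norm_le_norm_inv_pow {x : KInfty Fq} {n : ℕ} (hx : ∀ i < (n : ℤ), x.coeff i = 0) :
    ‖x‖ ≤ ‖varK Fq‖⁻¹ ^ n := by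
  rw [inv_pow, ← norm_pow, ← norm_inv, Valued.toNormedField.norm_le_iff, varK_pow_inv,
    LaurentSeries.valuation_single_zpow]
  exact (LaurentSeries.valuation_le_iff_coeff_lt_eq_zero Fq).2 hx

theorem tendsto_sum_coeff {x : KInfty Fq} (hx : ∀ i ≤ 0, x.coeff i = 0) :
    Tendsto (fun n => ∑ j ∈ Finset.range n,
      algebraMap Fq (KInfty Fq) (x.coeff (j + 1)) * (varK Fq ^ (j + 1))⁻¹) atTop (𝓝 x) := by
  rw [tendsto_iff_norm_sub_tendsto_zero]
  refine squeeze_zero (fun _ => norm_nonneg _) (fun n => ?_) (tendsto_pow_atTop_nhds_zero_of_lt_one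
    (inv_nonneg.2 (norm_nonneg _)) (inv_lt_one_of_one_lt₀ (one_lt_norm_varK (Fq := Fq))))
  rw [norm_sub_rev]
  refine norm_le_norm_inv_pow fun i hi => ?_
  simp_rw [varK_pow_inv, algebraMap_mul_single]
  rw [HahnSeries.coeff_sub, HahnSeries.coeff_sum, sub_eq_zero]
  by_cases h0 : i ≤ 0
  · rw [hx i h0]
    refine (Finset.sum_eq_zero fun j _ => ?_).symm
    rw [HahnSeries.coeff_single, if_neg (by push_cast; omega)]
  · obtain ⟨m, rfl⟩ : ∃ m : ℕ, i = m + 1 := ⟨(i - 1).toNat, by omega⟩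
    rw [Finset.sum_eq_single m]
    · simp
    · intro j _ hj
      rw [HahnSeries.coeff_single, if_neg (by push_cast; omega)]
    · intro hm
      exact absurd (Finset.mem_range.2 (by omega)) hm

/-- The image in `ℂ_∞` of a constant. -/
def constC (Fq : Type*) [Field Fq] [Fintype Fq] : Fq →+* CInfty Fq :=
  (toCInfty Fq).comp (algebraMap Fq (KInfty Fq))

theorem constC_pow_card (c : Fq) : constC Fq c ^ q = constC Fq c := by
  rw [← map_pow, FiniteField.pow_card]

variable {s : CInfty Fq}

theorem e_eq (x : KInfty Fq) :
    e Fq s x = expSeries q (varC Fq) (period q (varC Fq) s * toCInfty Fq x) := rfl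

theorem e_add (x y : KInfty Fq) : e Fq s (x + y) = e Fq s x + e Fq s y := by
  rw [e_eq, e_eq, e_eq, map_add, mul_add,
    expSeries_add one_lt_norm_varC one_lt_q (frobC Fq) frobC_apply]

theorem e_zero : e Fq s 0 = 0 := by
  rw [e_eq, map_zero, mul_zero, expSeries_zero one_lt_q]

theorem e_algebraMap_mul (c : Fq) (x : KInfty Fq) :
    e Fq s (algebraMap Fq (KInfty Fq) c * x) = constC Fq c * e Fq s x := by
  rw [e_eq, e_eq, map_mul, mul_left_comm]
  exact expSeries_mul_of_pow_eq (constC_pow_card c) _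

theorem e_varK_mul (x : KInfty Fq) :
    e Fq s (varK Fq * x) = varC Fq * e Fq s x + e Fq s x ^ q := by
  rw [e_eq, e_eq, map_mul, mul_left_comm]
  exact expSeries_theta_mul one_lt_norm_varC one_lt_q (frobC Fq) frobC_apply _

theorem e_varK_pow (hs : IsRootNegT Fq s) (n : ℕ) : e Fq s (varK Fq ^ n) = 0 := by
  rw [e_eq, map_pow, mul_comm]
  exact expSeries_pow_mul_period one_lt_norm_varC one_lt_q (frobC Fq) frobC_apply hs hs.ne_zero n

theorem e_varK_pow_inv (hs : IsRootNegT Fq s) (n : ℕ) :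
    e Fq s (varK Fq ^ (n + 1))⁻¹ = PowerSeries.coeff n (twistInv q (varC Fq) s) := by
  rw [e_eq, map_inv₀, map_pow]
  exact expSeries_period_div one_lt_norm_varC one_lt_q (frobC Fq) frobC_apply hs hs.ne_zero n

theorem e_polyToKInfty (hs : IsRootNegT Fq s) (p : Fq[X]) : e Fq s (polyToKInfty Fq p) = 0 := by
  induction p using Polynomial.induction_on' with
  | add p r hp hr => rw [map_add, e_add, hp, hr, add_zero]
  | monomial m c =>
    rw [← Polynomial.C_mul_X_pow_eq_monomial, map_mul, map_pow, polyToKInfty_C, polyToKInfty_X,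
      e_algebraMap_mul, e_varK_pow hs, mul_zero]

theorem e_frac_eq_of_dvd_sub (hs : IsRootNegT Fq s) {f : Fq[X]} (hf : f ≠ 0) {g h : Fq[X]}
    (hd : f ∣ g - h) : e Fq s (frac Fq g f) = e Fq s (frac Fq h f) := by
  obtain ⟨u, hu⟩ := hd
  rw [show g = f * u + h by rw [← hu, sub_add_cancel], frac_add, frac_mul_denom hf, e_add,
    e_polyToKInfty hs, zero_add]

/-- Removing the polynomial part does not change `e` and leaves an argument of norm at most `1`. -/
theorem exists_norm_e_le (hs : IsRootNegT Fq s) : ∃ B, ∀ x : KInfty Fq, ‖e Fq s x‖ ≤ B := by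
  obtain ⟨B, hB⟩ := exists_norm_expSeries_le (one_lt_norm_varC (Fq := Fq)) (one_lt_q (Fq := Fq))
    ‖period q (varC Fq) s‖
  refine ⟨B, fun x => ?_⟩
  obtain ⟨p, y, rfl, hy⟩ := exists_poly_add x
  rw [e_add, e_polyToKInfty hs, zero_add, e_eq]
  refine hB _ ?_
  rw [norm_mul, norm_toCInfty]
  exact mul_le_of_le_one_right (norm_nonneg _) (norm_le_one_of_coeff hy)

theorem continuous_e : Continuous (e Fq s) :=
  (continuous_expSeries one_lt_norm_varC one_lt_q (frobC Fq) frobC_apply).comp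
    (continuous_const.mul continuous_toCInfty)

/-! ### The pairing evaluated on the sequences `e(T^k x)` -/

/-- The sequence `e(T^k x)`. -/
def eSeq (s : CInfty Fq) (x : KInfty Fq) (k : ℕ) : CInfty Fq := e Fq s (varK Fq ^ k * x)

theorem eSeq_succ (x : KInfty Fq) (k : ℕ) :
    eSeq s x (k + 1) = varC Fq * eSeq s x k + eSeq s x k ^ q := by
  rw [eSeq, pow_succ', mul_assoc, e_varK_mul]; rfl

theorem eSeq_shift (x : KInfty Fq) : (fun k => eSeq s x (k + 1)) = eSeq s (varK Fq * x) := by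
  ext k; rw [eSeq, eSeq, pow_succ, mul_assoc]

theorem exists_norm_eSeq_le (hs : IsRootNegT Fq s) (x : KInfty Fq) :
    ∃ B, ∀ k, ‖eSeq s x k‖ ≤ B := by
  obtain ⟨B, hB⟩ := exists_norm_e_le hs
  exact ⟨B, fun k => hB _⟩

/-- For `k ≤ j` the argument is still a negative power of `T`, giving `λ_(j-k)`; afterwards it is a
polynomial, which `e` kills. -/
theorem eSeq_varK_pow_inv (hs : IsRootNegT Fq s) (j : ℕ) :
    eSeq s (varK Fq ^ (j + 1))⁻¹ = twistInvSeq q (varC Fq) s j := by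
  have h0 := varK_ne_zero (Fq := Fq)
  ext k
  rw [eSeq, twistInvSeq]
  split_ifs with h
  · obtain ⟨m, rfl⟩ := Nat.exists_eq_add_of_le h
    rw [Nat.add_sub_cancel_left, ← e_varK_pow_inv hs m, add_assoc, pow_add, mul_inv,
      mul_inv_cancel_left₀ (pow_ne_zero _ h0)]
  · obtain ⟨m, rfl⟩ := Nat.exists_eq_add_of_lt (not_le.1 h)
    rw [show j + m + 1 = m + (j + 1) by omega, pow_add,
      mul_inv_cancel_right₀ (pow_ne_zero _ h0), e_varK_pow hs]

theorem summable_pairing_eSeq (hs : IsRootNegT Fq s) (m n : ℕ) (x : KInfty Fq) :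
    Summable fun k => PowerSeries.coeff k (twist q (varC Fq) s) ^ q ^ m * eSeq s x k ^ q ^ n := by
  obtain ⟨B, hB⟩ := exists_norm_eSeq_le hs x
  exact summable_pairing one_lt_norm_varC one_lt_q m n hB

/-- The homomorphism `x ↦ ∑_k α_k^(q^m) e(T^k x)`. -/
def pairingHom (hs : IsRootNegT Fq s) (m : ℕ) : KInfty Fq →+ CInfty Fq where
  toFun x := pairing q (varC Fq) s m 0 (eSeq s x)
  map_zero' := by simp [pairing, eSeq, e_zero]
  map_add' x y := by
    rw [pairing, pairing, pairing,
      ← (summable_pairing_eSeq hs m 0 x).tsum_add (summable_pairing_eSeq hs m 0 y)]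
    refine tsum_congr fun k => ?_
    rw [pow_zero, pow_one, pow_one, pow_one, eSeq, mul_add, e_add, mul_add]
    rfl

theorem pairingHom_apply (hs : IsRootNegT Fq s) (m : ℕ) (x : KInfty Fq) :
    pairingHom hs m x = pairing q (varC Fq) s m 0 (eSeq s x) := rfl

theorem pairingHom_algebraMap_mul (hs : IsRootNegT Fq s) (m : ℕ) (c : Fq) (x : KInfty Fq) :
    pairingHom hs m (algebraMap Fq (KInfty Fq) c * x) = constC Fq c * pairingHom hs m x := by
  rw [pairingHom_apply, pairingHom_apply, pairing, pairing, ← tsum_mul_left]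
  refine tsum_congr fun k => ?_
  rw [eSeq, mul_left_comm, e_algebraMap_mul, pow_zero, pow_one, pow_one, mul_left_comm]
  rfl

theorem continuous_pairingHom (hs : IsRootNegT Fq s) (m : ℕ) : Continuous (pairingHom hs m) := by
  obtain ⟨B, hB⟩ := exists_norm_e_le hs
  refine continuous_tsum (F := CInfty Fq) (fun k => ?_)
    ((summable_norm_coeff_twist_pow (s := s) one_lt_norm_varC (one_lt_q (Fq := Fq)) m).mul_right B)
    fun k x => ?_
  · exact continuous_const.mul
      ((continuous_e.comp (continuous_const.mul continuous_id)).pow _)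
  · rw [norm_mul, pow_zero, pow_one]
    exact mul_le_mul_of_nonneg_left (hB _) (norm_nonneg _)

theorem tendsto_sum_pairingHom (hs : IsRootNegT Fq s) (m : ℕ) {x : KInfty Fq}
    (hx : ∀ i ≤ 0, x.coeff i = 0) :
    Tendsto (fun n => ∑ j ∈ Finset.range n, constC Fq (x.coeff (j + 1)) *
      pairing q (varC Fq) s m 0 (twistInvSeq q (varC Fq) s j)) atTop (𝓝 (pairingHom hs m x)) := by
  refine (((continuous_pairingHom hs m).tendsto x).comp (tendsto_sum_coeff hx)).congr fun n => ?_
  simp only [Function.comp_apply]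
  rw [map_sum]
  refine Finset.sum_congr rfl fun j _ => ?_
  rw [pairingHom_algebraMap_mul, pairingHom_apply, eSeq_varK_pow_inv hs]

theorem pairing_zero_eSeq (hs : IsRootNegT Fq s) {x : KInfty Fq} (hx : ∀ i ≤ 0, x.coeff i = 0) :
    pairing q (varC Fq) s 0 0 (eSeq s x) = constC Fq (x.coeff 1) := by
  refine tendsto_nhds_unique (tendsto_sum_pairingHom hs 0 hx)
    (tendsto_const_nhds.congr' ?_)
  -- Only `j = 0` contributes, so the partial sums are constant once they are nonempty.
  filter_upwards [eventually_ge_atTop 1] with n hn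
  simp_rw [pairing_zero_twistInvSeq one_lt_norm_varC one_lt_q hs.ne_zero]
  rw [Finset.sum_eq_single 0]
  · simp
  · intro j _ hj
    rw [if_neg hj, mul_zero]
  · intro h
    exact absurd (Finset.mem_range.2 (by omega)) h

theorem pairing_one_eSeq (hs : IsRootNegT Fq s) {x : KInfty Fq} (hx : ∀ i ≤ 0, x.coeff i = 0) :
    pairing q (varC Fq) s 1 0 (eSeq s x) = -toCInfty Fq x := by
  refine tendsto_nhds_unique (tendsto_sum_pairingHom hs 1 hx) ?_
  refine ((continuous_toCInfty.tendsto x).comp (tendsto_sum_coeff hx)).neg.congr fun n => ?_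
  simp only [Function.comp_apply]
  rw [map_sum, ← Finset.sum_neg_distrib]
  refine Finset.sum_congr rfl fun j _ => ?_
  rw [pairing_one_twistInvSeq one_lt_norm_varC one_lt_q (frobC Fq) frobC_apply hs hs.ne_zero,
    map_mul, map_inv₀, map_pow, mul_neg]
  rfl

theorem varK_pow_sub_ne_zero (n : ℕ) : varK Fq ^ q ^ (n + 1) - varK Fq ≠ 0 := by
  have h1 : 1 < q ^ (n + 1) := Nat.one_lt_pow (by omega) one_lt_q
  have h := norm_pow_sub_pow (one_lt_norm_varK (Fq := Fq)) h1
  rw [pow_one] at h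
  rw [← norm_pos_iff, h]
  exact pow_pos (zero_lt_one.trans one_lt_norm_varK) _

theorem carlitzPsi_eq (N : ℕ) (z : KInfty Fq) : carlitzPsi Fq N z = psi Fq (varK Fq) N z := by
  have h1 : varK Fq = HahnSeries.single (-1 : ℤ) (1 : Fq) := varK_eq_single
  rw [← prodSub_div_prodSub varK_pow_sub_ne_zero, ← finprod_monic, ← finprod_degree_lt, h1]
  rfl

theorem pairing_succ_eSeq (hs : IsRootNegT Fq s) {x : KInfty Fq} (hx : ∀ i ≤ 0, x.coeff i = 0)
    (N : ℕ) : pairing q (varC Fq) s (N + 1) 0 (eSeq s x) = -toCInfty Fq (carlitzPsi Fq N x) := by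
  obtain ⟨B, hB⟩ := exists_norm_eSeq_le hs x
  rw [carlitzPsi_eq]
  induction N with
  | zero => exact pairing_one_eSeq hs hx
  | succ N ih =>
    have h0 : varC Fq ^ q ^ (N + 1) - varC Fq ≠ 0 := by
      have := (map_ne_zero (toCInfty Fq)).2 (varK_pow_sub_ne_zero (Fq := Fq) N)
      rwa [map_sub, map_pow] at this
    have h1 := congrArg (toCInfty Fq) (mul_psi_succ (F := Fq) varK_pow_sub_ne_zero N x)
    rw [map_mul, map_sub, map_sub, map_pow, map_pow] at h1
    have h2 := pairing_succ_mul one_lt_norm_varC one_lt_q (frobC Fq) frobC_apply hs hs.ne_zero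
      (N + 1) hB (eSeq_succ x)
    have h3 : ∀ y : CInfty Fq, (-y) ^ q = -y ^ q := map_neg (frobC Fq)
    refine mul_left_cancel₀ h0 (h2.trans ?_)
    rw [ih, h3, mul_neg]
    refine Eq.trans ?_ (congrArg Neg.neg h1.symm)
    ring

/-- In `P_{0,n}(T x) = θ^(q^n) P_{0,n}(x) + P_{0,n+1}(x)` the middle term is a vanishing coefficient
of `x`, so raising `n` amounts to replacing `x` by `T x`. -/
theorem pairing_zero_pow_eSeq (hs : IsRootNegT Fq s) (n : ℕ) {x : KInfty Fq}
    (hx : ∀ i ≤ (n : ℤ), x.coeff i = 0) :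
    pairing q (varC Fq) s 0 n (eSeq s x) = constC Fq (x.coeff (n + 1)) := by
  induction n generalizing x with
  | zero =>
    rw [pairing_zero_eSeq hs (by simpa using hx)]; simp
  | succ n ih =>
    obtain ⟨B, hB⟩ := exists_norm_eSeq_le hs x
    have h := pairing_shift_right (s := s) one_lt_norm_varC one_lt_q (frobC Fq) frobC_apply 0 n
      hB (eSeq_succ x)
    have hc : ∀ i : ℤ, (varK Fq * x).coeff i = x.coeff (i + 1) := fun i => by
      simpa using coeff_varK_pow_mul 1 x i
    rw [eSeq_shift, ih fun i hi => by rw [hc]; exact hx _ (by push_cast; omega),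
      ih fun i hi => hx _ (by push_cast; omega), hc, hx (n + 1) (by push_cast; omega), map_zero,
      mul_zero, zero_add] at h
    rw [← h]; push_cast; rfl

theorem norm_constC_le (c : Fq) : ‖constC Fq c‖ ≤ 1 := by
  have h := congrArg norm (constC_pow_card c)
  rw [norm_pow] at h
  by_contra hlt
  exact absurd h (lt_self_pow₀ (not_le.1 hlt) one_lt_q).ne'

/-! ### The function `e*` and dual families -/

/-- The sequence `Res(T^k x)`, with values in `ℂ_∞`. -/
def resSeq (x : KInfty Fq) (k : ℕ) : CInfty Fq := constC Fq (res Fq (varK Fq ^ k * x))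

theorem norm_resSeq_le (x : KInfty Fq) (k : ℕ) : ‖resSeq x k‖ ≤ 1 := norm_constC_le _

theorem resSeq_pow (x : KInfty Fq) (k n : ℕ) : resSeq x k ^ q ^ n = resSeq x k :=
  pow_pow_eq_self (constC_pow_card _) n

/-- Residues lie in `𝔽_q`, so raising to the power `q^m` affects only the `α_k`. -/
theorem eStar_pow (x : KInfty Fq) (m : ℕ) :
    eStar Fq s x ^ q ^ m = pairing q (varC Fq) s m 0 (resSeq x) := by
  have h1 : eStar Fq s x ^ q ^ m = pairing q (varC Fq) s m m (resSeq x) := by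
    induction m with
    | zero =>
      rw [pow_zero, pow_one, eStar, pairing]
      refine tsum_congr fun k => ?_
      rw [pow_zero, pow_one, pow_one, mul_comm]; rfl
    | succ m ih =>
      rw [pairing_succ_succ one_lt_norm_varC one_lt_q (frobC Fq) frobC_apply m m
        (norm_resSeq_le x), ← ih, ← pow_mul, pow_succ]
  rw [h1, pairing, pairing]
  exact tsum_congr fun k => by rw [resSeq_pow, resSeq_pow]

theorem e_sum {ι : Type*} (S : Finset ι) (x : ι → KInfty Fq) :
    e Fq s (∑ i ∈ S, x i) = ∑ i ∈ S, e Fq s (x i) :=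
  map_sum (AddMonoidHom.mk' (e Fq s) e_add) x S

/-- The residues are the coordinates of `T^k` in the `b_i` modulo `f`; multiples of `f` disappear
under `e`. -/
theorem sum_resSeq_mul_e (hs : IsRootNegT Fq s) {f : Fq[X]} (hf : f.Monic)
    {a b : Fin f.natDegree → Fq[X]} (hab : IsDualFamily Fq f a b) (c : Fq[X]) (k : ℕ) :
    ∑ i, resSeq (frac Fq (a i) f) k * e Fq s (frac Fq (b i * c) f) =
      eSeq s (frac Fq c f) k := by
  have h1 : ∀ i, resSeq (frac Fq (a i) f) k * e Fq s (frac Fq (b i * c) f) =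
      e Fq s (frac Fq (Polynomial.C (resFrac f (Polynomial.X ^ k) (a i)) * b i * c) f) :=
    fun i => by
      rw [mul_assoc, frac_mul_left _ (b i * c), polyToKInfty_C, e_algebraMap_mul, resSeq,
        resFrac_apply, mul_comm (a i), frac_mul_left (Polynomial.X ^ k), map_pow, polyToKInfty_X]
  have h2 : ∑ i, frac Fq (Polynomial.C (resFrac f (Polynomial.X ^ k) (a i)) * b i * c) f =
      frac Fq ((∑ i, Polynomial.C (resFrac f (Polynomial.X ^ k) (a i)) * b i) * c) f := by
    rw [Finset.sum_mul, frac, map_sum, Finset.sum_div]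
    rfl
  have h3 : f ∣ Polynomial.X ^ k * c -
      (∑ i, Polynomial.C (resFrac f (Polynomial.X ^ k) (a i)) * b i) * c := by
    rw [← sub_mul]
    exact (hab.dvd_sub hf _).mul_right c
  simp_rw [h1]
  rw [← e_sum, h2, ← e_frac_eq_of_dvd_sub hs hf.ne_zero h3, frac_mul_left, map_pow,
    polyToKInfty_X]
  rfl

theorem sum_pow_pow {ι : Type*} (S : Finset ι) (x : ι → CInfty Fq) (n : ℕ) :
    (∑ i ∈ S, x i) ^ q ^ n = ∑ i ∈ S, x i ^ q ^ n :=
  map_sum (AddMonoidHom.mk' (fun y : CInfty Fq => y ^ q ^ n)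
    fun y z => pow_pow_add (frobC Fq) frobC_apply y z n) x S

theorem sum_eStar_mul_e (hs : IsRootNegT Fq s) {f : Fq[X]} (hf : f.Monic)
    {a b : Fin f.natDegree → Fq[X]} (hab : IsDualFamily Fq f a b) (c : Fq[X]) (m n : ℕ) :
    ∑ i, eStar Fq s (frac Fq (a i) f) ^ q ^ m * e Fq s (frac Fq (b i * c) f) ^ q ^ n =
      pairing q (varC Fq) s m n (eSeq s (frac Fq c f)) := by
  have hsum : ∀ i ∈ Finset.univ, Summable fun k =>
      PowerSeries.coeff k (twist q (varC Fq) s) ^ q ^ m * resSeq (frac Fq (a i) f) k ^ q ^ 0 *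
        e Fq s (frac Fq (b i * c) f) ^ q ^ n := fun i _ =>
    (summable_pairing (g := resSeq (frac Fq (a i) f)) one_lt_norm_varC one_lt_q m 0
      (norm_resSeq_le _)).mul_right _
  simp_rw [eStar_pow, pairing, ← tsum_mul_right]
  rw [← Summable.tsum_finsetSum hsum]
  refine tsum_congr fun k => ?_
  rw [← sum_resSeq_mul_e hs hf hab, sum_pow_pow, Finset.mul_sum]
  refine Finset.sum_congr rfl fun i _ => ?_
  rw [mul_pow, resSeq_pow, resSeq_pow, mul_assoc]

end CInfty

end Carlitz

end

theorem theorem4p4p4 (Fq : Type*) [Field Fq] [Fintype Fq]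
    (s : Carlitz.CInfty Fq) (hs : Carlitz.IsRootNegT Fq s)
    (f : Polynomial Fq) (hf : f.Monic)
    (a b : Fin f.natDegree → Polynomial Fq) (hab : Carlitz.IsDualFamily Fq f a b)
    (c : Polynomial Fq) (hc : c.degree < f.degree) :
    (∀ N : ℕ,
      ∑ i, Carlitz.eStar Fq s (Carlitz.frac Fq (a i) f) ^ (Fintype.card Fq ^ (N + 1)) *
          Carlitz.e Fq s (Carlitz.frac Fq (b i * c) f) =
        -Carlitz.toCInfty Fq (Carlitz.carlitzPsi Fq N (Carlitz.frac Fq c f))) ∧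
    (c.Monic →
      ∑ i, Carlitz.eStar Fq s (Carlitz.frac Fq (a i) f) *
          Carlitz.e Fq s (Carlitz.frac Fq (b i * c) f) ^
            (Fintype.card Fq ^ (f.natDegree - c.natDegree - 1)) = 1) := by
  refine ⟨fun N => ?_, fun hcm => ?_⟩
  · have h := Carlitz.sum_eStar_mul_e hs hf hab c (N + 1) 0
    simp only [pow_zero, pow_one] at h
    rw [h]
    exact Carlitz.pairing_succ_eSeq hs (fun i hi => Carlitz.coeff_frac_of_degree_lt hc hi) N
  · have h := Carlitz.sum_eStar_mul_e hs hf hab c 0 (f.natDegree - c.natDegree - 1)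
    simp only [pow_zero, pow_one] at h
    have hlt := Polynomial.natDegree_lt_natDegree hcm.ne_zero hc
    -- The natural subtraction is exact as `deg c < deg f`; the index is then the order of `c/f`,
    -- where its coefficient is the leading one of `c`.
    have h1 : ((f.natDegree - c.natDegree - 1 : ℕ) : ℤ) + 1 = f.natDegree - c.natDegree := by omega
    rw [h, Carlitz.pairing_zero_pow_eSeq hs _
      fun i hi => Carlitz.coeff_frac_eq_zero hf.ne_zero (by omega), h1,
      Carlitz.coeff_frac_eq_leadingCoeff hcm.ne_zero hf, hcm.leadingCoeff, map_one]
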